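/- Let $Q=(q_n)_{n\ge1}$ be a sequence of integers $q_n\ge 2$ with $q_n\to\infty$. Every real $x$ has a unique $Q$-Cantor series expansion $x=E_0+\sum_{n\ge1}\frac{E_n}{q_1\cdots q_n}$ with $E_0=\lfloor x\rfloor$, $E_n\in\{0,\dots,q_n-1\}$ for $n\ge1$, and $E_n\ne q_n-1$ infinitely often. Put $T_{Q,n}(x)=q_nq_{n-1}\cdots q_1x \pmod 1\in[0,1)$ for $n\ge0$, so that $\frac{E_{n+1}}{q_{n+1}}\le T_{Q,n}(x)<\frac{E_{n+1}+1}{q_{n+1}}$. An asymptotic distribution function (adf) is a non-decreasing $f:[0,1]\to[0,1]$ with $f(0)=0$, $f(1)=1$. A sequence $\omega$ in $[0,1)$ has upper adf $\overline f$ (lower adf $\underline f$) if for every $t\in[0,1]$ the $\limsup$ (the $\liminf$) as $n\to\infty$ of $\frac1n A_n([0,t),\omega)$ is $\overline f(t)$ (is $\underline f(t)$), where $A_n(S,\omega)$ is the number of the first $n$ terms of $\omega$ that lie in $S$. A linear family of adfs is a family $\{f_{m,r}\}_{m\ge1,\,0\le r<m}$ of adfs with $f_{m,r}=\frac1d\sum_{i=0}^{d-1}f_{md,mi+r}$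 for all $m\ge1$, $0\le r<m$, $d\ge1$. A function $f:[0,1]\to[0,1]$ is increasing at $x$ if there are points $y<x$ arbitrarily close to $x$ with $f(y)<f(x)$, or points $y>x$ arbitrarily close to $x$ with $f(x)<f(y)$; $I(f)$ denotes the closure of the set of points of $[0,1]$ at which $f$ is increasing. A point $a$ is an accumulation point of a sequence if every neighbourhood of $a$ contains infinitely many terms of it, counted with multiplicity. Theorem. Let $\{\overline f_{m,r}\}$ and $\{\underline f_{m,r}\}$ be linear families of adfs with $\underline f_{m,r}\le\overline f_{m,r}$ for all $m\ge1$, $0\le r<m$. Then the set of all real $x$ such that for all $m\ge1$ and $0\le r<m$ the sequence $\{T_{Q,mn+r}(x)\}_{n\ge0}$ has upper adf $\overline f_{m,r}$ and lower adf $\underline f_{m,r}$, and the set of accumulation points of $\left\{\frac{E_{mn+r+1}(x)}{q_{mn+r+1}}\right\}_{n\ge0}$ is equal to $I(\overline f_{m,r})\cup I(\underline f_{m,r})$, has Hausdorff dimension $1$. -/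

import Mathlib

open Filter Topology

/-- `q` is a basic sequence: integers `q 1, q 2, …`, all at least `2`.
The value `q 0` plays no role. -/
def IsBasicSequence (q : ℕ → ℕ) : Prop :=
  ∀ n, 1 ≤ n → 2 ≤ q n

/-- `q` is infinite in limit: `q n → ∞`. -/
def InfiniteInLimit (q : ℕ → ℕ) : Prop :=
  Tendsto q atTop atTop

/-- `T_{Q,n}(x) = q_n q_{n-1} ⋯ q_1 x (mod 1)`; in particular `T_{Q,0}(x) = x (mod 1)`. -/
noncomputable def cantorT (q : ℕ → ℕ) (n : ℕ) (x : ℝ) : ℝ :=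
  Int.fract ((∏ i ∈ Finset.Icc 1 n, (q i : ℝ)) * x)

/-- `E` is the sequence of digits of the `Q`-Cantor series expansion of `x`:
`x = E_0 + ∑_{n ≥ 1} E_n / (q_1 ⋯ q_n)` with `E_0 = ⌊x⌋`, `0 ≤ E_n ≤ q_n - 1` for `n ≥ 1`, and
`E_n ≠ q_n - 1` infinitely often. (The series is indexed from `0` here, hence the `n + 1`.) -/
structure IsCantorExpansion (q : ℕ → ℕ) (x : ℝ) (E : ℕ → ℤ) : Prop where
  floor : E 0 = ⌊x⌋
  nonneg : ∀ n, 1 ≤ n → 0 ≤ E n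
  le : ∀ n, 1 ≤ n → E n ≤ (q n : ℤ) - 1
  frequently_ne : ∃ᶠ n in atTop, E n ≠ (q n : ℤ) - 1
  hasSum : HasSum (fun n : ℕ => (E (n + 1) : ℝ) / ∏ i ∈ Finset.Icc 1 (n + 1), (q i : ℝ))
    (x - (E 0 : ℝ))

open Classical in
/-- `A_n(S, ω)`: the number of the first `n` terms of `ω = (ω_0, ω_1, …)` that lie in `S`. -/
noncomputable def countIn (S : Set ℝ) (ω : ℕ → ℝ) (n : ℕ) : ℕ :=
  ((Finset.range n).filter (fun i => ω i ∈ S)).card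

/-- An asymptotic distribution function: non-decreasing `f : [0,1] → [0,1]` with
`f 0 = 0` and `f 1 = 1`. -/
structure IsADF (f : unitInterval → unitInterval) : Prop where
  monotone : Monotone f
  map_zero : f 0 = 0
  map_one : f 1 = 1

/-- `f` is the upper asymptotic distribution function of `ω`
(the quotients lie in `[0,1]`, so the real `limsup` is the usual one). -/
def HasUpperADF (ω : ℕ → ℝ) (f : unitInterval → unitInterval) : Prop :=
  ∀ t : unitInterval,
    limsup (fun n : ℕ => (countIn (Set.Ico 0 (t : ℝ)) ω n : ℝ) / n) atTop = (f t : ℝ)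

/-- `f` is the lower asymptotic distribution function of `ω`. -/
def HasLowerADF (ω : ℕ → ℝ) (f : unitInterval → unitInterval) : Prop :=
  ∀ t : unitInterval,
    liminf (fun n : ℕ => (countIn (Set.Ico 0 (t : ℝ)) ω n : ℝ) / n) atTop = (f t : ℝ)

/-- A linear family of asymptotic distribution functions `f_{m,r}`, `m ≥ 1`, `0 ≤ r < m`:
`f_{m,r} = (1/d) ∑_{i<d} f_{md, mi+r}` for all `d ≥ 1`. Only the `f m r` with `r < m` matter. -/
structure IsLinearFamilyADF (f : ℕ → ℕ → unitInterval → unitInterval) : Prop where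
  isADF : ∀ m r : ℕ, r < m → IsADF (f m r)
  linear : ∀ m r d : ℕ, r < m → 1 ≤ d → ∀ t : unitInterval,
    (f m r t : ℝ) = (1 / (d : ℝ)) * ∑ i ∈ Finset.range d, (f (m * d) (m * i + r) t : ℝ)

/-- `f` is increasing at `x`: there are points `y < x` arbitrarily close to `x` with `f y < f x`,
or points `y > x` arbitrarily close to `x` with `f x < f y`. -/
def IncreasingAt (f : unitInterval → unitInterval) (x : unitInterval) : Prop :=
  (∃ᶠ y in 𝓝[<] x, f y < f x) ∨ (∃ᶠ y in 𝓝[>] x, f x < f y)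

/-- `I(f)`: the closure of the set of points of `[0,1]` at which `f` is increasing. -/
def increaseSet (f : unitInterval → unitInterval) : Set unitInterval :=
  closure {x | IncreasingAt f x}

/-- The set of accumulation points of a sequence of real numbers, i.e. of the points each
neighbourhood of which contains `u n` for infinitely many `n`. -/
def accPoints (u : ℕ → ℝ) : Set ℝ :=
  {a | MapClusterPt a atTop u}

/-! Only the lower bound on the dimension needs an argument. It comes from prescribing, for each
`n`, a window of consecutive admissible digits, such that every point with digits in these windows
has all the required properties.

The windows come in stages that follow the upper family and the lower family alternately. In stage
`k` the positions are split by residue modulo `k!`, and within a class the levels `1/(k+1), …,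
(k+1)/(k+1)` are used cyclically. At level `y` the term is confined to a short interval next to the
point where the distribution function of the class passes `y` (`IsLevelWindow`), so `k + 1`
consecutive terms of the class imitate that function. For a fixed `m`, once `k ≥ m` a class modulo
`m` is a union of classes modulo `k!`; linearity of the family adds up the contributions, and bounds
the sum of all the errors by the variation of the one function `f_{m,r}` near `t`, with `t` itself
left out (`sum_nearVariation`, `abs_period_sum_le`). This tends to `0` even at a jump. Hence the
counting averages are asymptotic to averages of values of `fup` and `flow`, which stay between the
two; each stage is so much longer than everything before it that both extremes are approached
(`tendsto_average_run`).

For the accumulation points, a level window touches a point of increase of its function, and by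
linearity of `f_{m,r}`. Conversely, where an upper or lower distribution function increases, terms
must recur (`HasUpperADF.frequently_mem`, `HasLowerADF.frequently_mem`). The quotients of digits by
bases differ from the orbit by at most `1/q_n → 0`.

For the dimension, stages start so late that a window at `n` has at least `q_{n+1} / q_n^ε` digits
for every `ε > 0` and large `n`. Reading the position of each digit in its window as a digit in the
Cantor series with bases `w` maps the coded points back onto `[0, 1)`, and this map is Hölder of
every exponent `r < 1` (`exists_holder_bound`). So their set has dimension at least `r`. -/

/-! ### Cantor series without maximal digits. -/

/-- `q_1 ⋯ q_n` as a real number. -/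
noncomputable def cantorProd (q : ℕ → ℕ) (n : ℕ) : ℝ := ∏ i ∈ Finset.Icc 1 n, (q i : ℝ)

/-- The real number in `[0, 1]` whose `(n + 1)`-st Cantor series digit is `d n`. -/
noncomputable def cantorPoint (q d : ℕ → ℕ) : ℝ := ∑' n, (d n : ℝ) / cantorProd q (n + 1)

/-- The numerator of the `n`-th partial sum of the Cantor series with digits `d`. -/
def cantorNum (q d : ℕ → ℕ) : ℕ → ℕ
  | 0 => 0
  | n + 1 => q (n + 1) * cantorNum q d n + d n

@[simp] lemma cantorProd_zero (q : ℕ → ℕ) : cantorProd q 0 = 1 := by simp [cantorProd]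

lemma cantorProd_succ (q : ℕ → ℕ) (n : ℕ) :
    cantorProd q (n + 1) = cantorProd q n * q (n + 1) := by
  simp [cantorProd, Finset.prod_Icc_succ_top]

section
variable {q : ℕ → ℕ} (hq : IsBasicSequence q)
include hq

lemma IsBasicSequence.two_le_cast (n : ℕ) : (2 : ℝ) ≤ q (n + 1) := by
  exact_mod_cast hq (n + 1) (by omega)

lemma IsBasicSequence.cantorProd_pos (n : ℕ) : 0 < cantorProd q n := by
  induction n with
  | zero => simp
  | succ n ih =>
    rw [cantorProd_succ]
    have := hq.two_le_cast n
    positivity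

lemma IsBasicSequence.two_pow_le_cantorProd (n : ℕ) : (2 : ℝ) ^ n ≤ cantorProd q n := by
  induction n with
  | zero => simp
  | succ n ih =>
    rw [cantorProd_succ, pow_succ]
    exact mul_le_mul ih (hq.two_le_cast n) (by norm_num) (hq.cantorProd_pos n).le

lemma IsBasicSequence.tendsto_cantorProd : Tendsto (cantorProd q) atTop atTop :=
  tendsto_atTop_mono hq.two_pow_le_cantorProd (tendsto_pow_atTop_atTop_of_one_lt (by norm_num))

lemma IsBasicSequence.one_le_cantorProd (n : ℕ) : 1 ≤ cantorProd q n :=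
  (one_le_pow₀ (by norm_num)).trans (hq.two_pow_le_cantorProd n)

lemma IsBasicSequence.sum_range_eq (d : ℕ → ℕ) (n : ℕ) :
    ∑ i ∈ Finset.range n, (d i : ℝ) / cantorProd q (i + 1) = cantorNum q d n / cantorProd q n := by
  induction n with
  | zero => simp [cantorNum]
  | succ n ih =>
    have h1 := hq.cantorProd_pos n
    have h2 := hq.two_le_cast n
    rw [Finset.sum_range_succ, ih, cantorProd_succ, cantorNum]
    push_cast
    field_simp

variable {d : ℕ → ℕ} (hd : ∀ n, d n + 2 ≤ q (n + 1))
include hd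

/-- The numerators over the common denominator differ by `q (n + 1) - d n - 1 > 0`. Since maximal
digits are excluded, right endpoints of cylinders strictly decrease; this gives the strict bound in
`cantorPoint_lt`, and with it the floor of each multiple. -/
lemma IsBasicSequence.upper_lt (n : ℕ) :
    ((cantorNum q d (n + 1) : ℝ) + 1) / cantorProd q (n + 1)
      < ((cantorNum q d n : ℝ) + 1) / cantorProd q n := by
  have h1 := hq.cantorProd_pos n
  have h2 := hq.two_le_cast n
  have h3 : (d n : ℝ) + 2 ≤ q (n + 1) := by exact_mod_cast hd n
  rw [cantorProd_succ, cantorNum, div_lt_div_iff₀ (by positivity) h1]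
  push_cast
  have : 0 < cantorProd q n * (q (n + 1) - d n - 1) := mul_pos h1 (by linarith)
  nlinarith

lemma IsBasicSequence.sum_range_le (n N : ℕ) :
    ∑ i ∈ Finset.range N, (d i : ℝ) / cantorProd q (i + 1)
      ≤ ((cantorNum q d n : ℝ) + 1) / cantorProd q n := by
  have hnn : ∀ i, 0 ≤ (d i : ℝ) / cantorProd q (i + 1) := fun i =>
    div_nonneg (Nat.cast_nonneg _) (hq.cantorProd_pos _).le
  have h1 : ∑ i ∈ Finset.range N, (d i : ℝ) / cantorProd q (i + 1)
      ≤ ∑ i ∈ Finset.range (max n N), (d i : ℝ) / cantorProd q (i + 1) :=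
    Finset.sum_le_sum_of_subset_of_nonneg (Finset.range_mono (le_max_right _ _))
      (fun i _ _ => hnn i)
  have hanti : Antitone fun n => ((cantorNum q d n : ℝ) + 1) / cantorProd q n :=
    antitone_nat_of_succ_le fun n => (hq.upper_lt hd n).le
  refine h1.trans (le_trans ?_ (hanti (le_max_left n N)))
  rw [hq.sum_range_eq]
  have := hq.cantorProd_pos (max n N)
  exact div_le_div_of_nonneg_right (by linarith) this.le

lemma IsBasicSequence.summable_digits :
    Summable fun n => (d n : ℝ) / cantorProd q (n + 1) :=
  summable_of_sum_range_le (fun _ => div_nonneg (Nat.cast_nonneg _) (hq.cantorProd_pos _).le)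
    (hq.sum_range_le hd 0)

lemma IsBasicSequence.le_cantorPoint (n : ℕ) :
    (cantorNum q d n : ℝ) / cantorProd q n ≤ cantorPoint q d := by
  rw [← hq.sum_range_eq]
  exact (hq.summable_digits hd).sum_le_tsum _ fun _ _ =>
    div_nonneg (Nat.cast_nonneg _) (hq.cantorProd_pos _).le

lemma IsBasicSequence.cantorPoint_lt (n : ℕ) :
    cantorPoint q d < ((cantorNum q d n : ℝ) + 1) / cantorProd q n := by
  refine lt_of_le_of_lt ?_ (hq.upper_lt hd n)
  exact Real.tsum_le_of_sum_range_le
    (fun i => div_nonneg (Nat.cast_nonneg _) (hq.cantorProd_pos _).le)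
    (hq.sum_range_le hd (n + 1))

lemma IsBasicSequence.cantorPoint_bounds (n : ℕ) :
    (cantorNum q d n : ℝ) ≤ cantorProd q n * cantorPoint q d ∧
      cantorProd q n * cantorPoint q d < cantorNum q d n + 1 := by
  have h1 := hq.le_cantorPoint hd n
  have h2 := hq.cantorPoint_lt hd n
  have h := hq.cantorProd_pos n
  rw [div_le_iff₀ h] at h1
  rw [lt_div_iff₀ h] at h2
  constructor <;> linarith

lemma IsBasicSequence.cantorPoint_mem : cantorPoint q d ∈ Set.Ico (0 : ℝ) 1 := by
  have := hq.cantorPoint_bounds hd 0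
  simpa [cantorNum] using this

lemma IsBasicSequence.cantorT_eq (n : ℕ) :
    cantorT q n (cantorPoint q d) = cantorProd q n * cantorPoint q d - cantorNum q d n := by
  have := hq.cantorPoint_bounds hd n
  have hfl : ⌊cantorProd q n * cantorPoint q d⌋ = (cantorNum q d n : ℤ) := by
    rw [Int.floor_eq_iff]
    exact_mod_cast this
  change Int.fract (cantorProd q n * cantorPoint q d) = _
  rw [Int.fract, hfl]
  simp

lemma IsBasicSequence.cantorT_mem (n : ℕ) :
    cantorT q n (cantorPoint q d) ∈
      Set.Ico ((d n : ℝ) / q (n + 1)) (((d n : ℝ) + 1) / q (n + 1)) := by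
  have h := hq.cantorPoint_bounds hd (n + 1)
  have h2 := hq.two_le_cast n
  rw [hq.cantorT_eq hd]
  rw [cantorProd_succ, cantorNum] at h
  push_cast at h
  constructor
  · rw [div_le_iff₀ (by linarith)]
    nlinarith [h.1]
  · rw [lt_div_iff₀ (by linarith)]
    nlinarith [h.2]

lemma IsBasicSequence.isCantorExpansion :
    IsCantorExpansion q (cantorPoint q d) (fun n => if n = 0 then 0 else (d (n - 1) : ℤ)) where
  floor := by
    have := hq.cantorPoint_mem hd
    simp only [if_true]
    exact (Int.floor_eq_zero_iff.2 this).symm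
  nonneg n hn := by
    rw [if_neg (by omega)]
    positivity
  le n hn := by
    rw [if_neg (by omega)]
    have := hd (n - 1)
    rw [Nat.sub_add_cancel hn] at this
    omega
  frequently_ne := by
    refine Eventually.frequently ?_
    filter_upwards [eventually_ge_atTop 1] with n hn
    rw [if_neg (by omega)]
    have := hd (n - 1)
    rw [Nat.sub_add_cancel hn] at this
    omega
  hasSum := by
    have := (hq.summable_digits hd).hasSum
    simpa [cantorPoint, cantorProd] using this

end

/-! ### Coding by digit windows and Hausdorff dimension. -/

/-- The `(n + 1)`-st Cantor digit, in the window `[a n, a n + w n)`, that encodes the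
`(n + 1)`-st digit of `z` in the Cantor series with bases `w`. -/
noncomputable def windowDigit (a w : ℕ → ℕ) (z : ℝ) (n : ℕ) : ℕ :=
  a n + (⌊(∏ i ∈ Finset.range (n + 1), (w i : ℝ)) * z⌋₊
    - w n * ⌊(∏ i ∈ Finset.range n, (w i : ℝ)) * z⌋₊)

section
variable {q a w : ℕ → ℕ} {z z' : ℝ}

/-- Ensures that the subtraction of natural numbers in `windowDigit` is not truncated. -/
lemma mul_floor_le_floor_prod (hz : 0 ≤ z) (n : ℕ) :
    w n * ⌊(∏ i ∈ Finset.range n, (w i : ℝ)) * z⌋₊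
      ≤ ⌊(∏ i ∈ Finset.range (n + 1), (w i : ℝ)) * z⌋₊ := by
  have h0 : 0 ≤ (∏ i ∈ Finset.range n, (w i : ℝ)) * z :=
    mul_nonneg (Finset.prod_nonneg fun _ _ => Nat.cast_nonneg _) hz
  apply Nat.le_floor
  rw [Finset.prod_range_succ]
  push_cast
  calc (w n : ℝ) * ⌊(∏ i ∈ Finset.range n, (w i : ℝ)) * z⌋₊
      ≤ w n * ((∏ i ∈ Finset.range n, (w i : ℝ)) * z) :=
        mul_le_mul_of_nonneg_left (Nat.floor_le h0) (Nat.cast_nonneg _)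
    _ = _ := by ring

lemma floor_prod_lt (hw : ∀ n, 1 ≤ w n) (hz : 0 ≤ z) (n : ℕ) :
    ⌊(∏ i ∈ Finset.range (n + 1), (w i : ℝ)) * z⌋₊
      < w n * ⌊(∏ i ∈ Finset.range n, (w i : ℝ)) * z⌋₊ + w n := by
  have h0 : 0 ≤ (∏ i ∈ Finset.range (n + 1), (w i : ℝ)) * z :=
    mul_nonneg (Finset.prod_nonneg fun _ _ => Nat.cast_nonneg _) hz
  rw [Nat.floor_lt h0, Finset.prod_range_succ]
  push_cast
  have h1 : (0 : ℝ) < w n := by exact_mod_cast hw n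
  have := mul_lt_mul_of_pos_left (Nat.lt_floor_add_one
    ((∏ i ∈ Finset.range n, (w i : ℝ)) * z)) h1
  linarith

lemma le_windowDigit (n : ℕ) : a n ≤ windowDigit a w z n := Nat.le_add_right _ _

lemma windowDigit_lt (hw : ∀ n, 1 ≤ w n) (hz : 0 ≤ z) (n : ℕ) :
    windowDigit a w z n < a n + w n := by
  have := floor_prod_lt hw hz n
  have := mul_floor_le_floor_prod (w := w) hz n
  unfold windowDigit
  omega

/-- Numerators of Cantor series with digits from the windows grow at least as fast as the
numerators of the encoded points. -/
lemma floor_prod_add_cantorNum_le (hwq : ∀ n, w n ≤ q (n + 1)) (hz : 0 ≤ z) (hzz : z ≤ z')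
    (hz' : z' < 1) (n : ℕ) :
    ⌊(∏ i ∈ Finset.range n, (w i : ℝ)) * z'⌋₊ + cantorNum q (windowDigit a w z) n
      ≤ cantorNum q (windowDigit a w z') n + ⌊(∏ i ∈ Finset.range n, (w i : ℝ)) * z⌋₊ := by
  induction n with
  | zero => simp [cantorNum, Nat.floor_eq_zero.2 hz', Nat.floor_eq_zero.2 (hzz.trans_lt hz')]
  | succ n ih =>
    have h1 := mul_floor_le_floor_prod (w := w) hz n
    have h2 := mul_floor_le_floor_prod (w := w) (hz.trans hzz) n
    have h3 : ⌊(∏ i ∈ Finset.range n, (w i : ℝ)) * z⌋₊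
        ≤ ⌊(∏ i ∈ Finset.range n, (w i : ℝ)) * z'⌋₊ :=
      Nat.floor_mono (mul_le_mul_of_nonneg_left hzz
        (Finset.prod_nonneg fun _ _ => Nat.cast_nonneg _))
    -- The gap of numerators is multiplied by `q (n + 1)` and the gap of floors only by `w n ≤ q (n
    -- + 1)`, before the same digit difference is added to both.
    simp only [cantorNum, windowDigit]
    zify [h1, h2] at *
    have h4 : (w n : ℤ) ≤ q (n + 1) := by exact_mod_cast hwq n
    have h5 : (0 : ℤ) ≤ w n := by positivity
    nlinarith

/-- Compare numerators at depth `n`: replacing the multiples of `z, z'` by floors costs 1, and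
replacing the multiples of the coded points costs 1 more. -/
lemma sub_le_of_windowDigit (hq : IsBasicSequence q) (hw : ∀ n, 1 ≤ w n)
    (haw : ∀ n, a n + w n + 1 ≤ q (n + 1)) (hz : 0 ≤ z) (hzz : z ≤ z') (hz' : z' < 1) (n : ℕ) :
    (∏ i ∈ Finset.range n, (w i : ℝ)) * (z' - z) ≤ cantorProd q n *
      |cantorPoint q (windowDigit a w z) - cantorPoint q (windowDigit a w z')| + 2 := by
  have hd : ∀ z, 0 ≤ z → ∀ n, windowDigit a w z n + 2 ≤ q (n + 1) := fun z hz n => by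
    have := windowDigit_lt (a := a) hw hz n
    have := haw n
    omega
  have h1 := (hq.cantorPoint_bounds (hd z hz) n).1
  have h2 := (hq.cantorPoint_bounds (hd z' (hz.trans hzz)) n).2
  have h2' := (hq.cantorPoint_bounds (hd z hz) n).2
  have h1' := (hq.cantorPoint_bounds (hd z' (hz.trans hzz)) n).1
  have h3 := floor_prod_add_cantorNum_le (a := a) (w := w) (q := q)
    (fun n => by have := haw n; omega) hz hzz hz' n
  have h4 := Nat.lt_floor_add_one ((∏ i ∈ Finset.range n, (w i : ℝ)) * z')
  have h5 := Nat.floor_le (a := (∏ i ∈ Finset.range n, (w i : ℝ)) * z)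
    (mul_nonneg (Finset.prod_nonneg fun _ _ => Nat.cast_nonneg _) hz)
  have h6 : (⌊(∏ i ∈ Finset.range n, (w i : ℝ)) * z'⌋₊ : ℝ) + cantorNum q (windowDigit a w z) n
      ≤ cantorNum q (windowDigit a w z') n + ⌊(∏ i ∈ Finset.range n, (w i : ℝ)) * z⌋₊ := by
    exact_mod_cast h3
  have h7 := mul_le_mul_of_nonneg_left (neg_abs_le
    (cantorPoint q (windowDigit a w z) - cantorPoint q (windowDigit a w z')))
    (hq.cantorProd_pos n).le
  nlinarith

/-- If the windows have relative size `q^{o(1)}`, decoding is Hölder for every exponent `r < 1`. -/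
lemma exists_holder_bound (hq : IsBasicSequence q) (hw : ∀ n, 1 ≤ w n)
    (haw : ∀ n, a n + w n + 1 ≤ q (n + 1)) {r C : ℝ} (hr1 : r < 1)
    (hC : ∀ n, cantorProd q (n + 1) ≤
      C * cantorProd q n ^ (1 - r) * ∏ i ∈ Finset.range (n + 1), (w i : ℝ))
    (hz : 0 ≤ z) (hzz : z ≤ z') (hz' : z' < 1) (hr0 : 0 < r) :
    z' - z ≤ 3 * C *
      |cantorPoint q (windowDigit a w z) - cantorPoint q (windowDigit a w z')| ^ r := by
  set h := |cantorPoint q (windowDigit a w z) - cantorPoint q (windowDigit a w z')| with hh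
  have hWpos : ∀ n, 0 < ∏ i ∈ Finset.range n, (w i : ℝ) := fun n =>
    Finset.prod_pos fun i _ => by exact_mod_cast hw i
  have hQ := hq.cantorProd_pos
  have hC0 : 0 < C := by
    by_contra hcon
    have h1 := hC 0
    have h2 := hQ 1
    have h3 := hWpos 1
    simp only [cantorProd_zero, Real.one_rpow, mul_one, zero_add] at h1
    nlinarith
  -- The numerator comparison at depth `n + 1`, divided by the product of the `w i`. The loss is a
  -- power of the product up to `n` only, which matters because `q (n + 1)` may be far larger than
  -- that product.
  have key : ∀ n, z' - z ≤ C * cantorProd q n ^ (1 - r) * (h + 2 / cantorProd q (n + 1)) := by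
    intro n
    have h1 := sub_le_of_windowDigit hq hw haw hz hzz hz' (n + 1)
    rw [← hh] at h1
    have hW := hWpos (n + 1)
    have hQ1 := hQ (n + 1)
    have h2 : cantorProd q (n + 1) * h + 2 = cantorProd q (n + 1) *
        (h + 2 / cantorProd q (n + 1)) := by field_simp
    have h3 : 0 ≤ h + 2 / cantorProd q (n + 1) := by positivity
    have h4 := mul_le_mul_of_nonneg_right (hC n) h3
    rw [h2] at h1
    refine le_of_mul_le_mul_left (h1.trans (h4.trans (le_of_eq ?_))) hW
    ring
  have hd : ∀ z, 0 ≤ z → ∀ n, windowDigit a w z n + 2 ≤ q (n + 1) := fun z hz n => by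
    have := windowDigit_lt (a := a) hw hz n
    have := haw n
    omega
  have hh0 : 0 ≤ h := abs_nonneg _
  -- If the coded points coincide, letting `n → ∞` in `key` gives `z = z'`; this is what makes the
  -- coding injective. Otherwise `n` is chosen with `cantorProd q n ≤ 1/h < cantorProd q (n + 1)`.
  rcases hh0.eq_or_lt with h0 | hpos
  · rw [← h0, Real.zero_rpow hr0.ne', mul_zero]
    have hlim : Tendsto (fun n => 2 * C * cantorProd q n ^ (-r)) atTop (𝓝 (2 * C * 0)) :=
      ((tendsto_rpow_neg_atTop hr0).comp hq.tendsto_cantorProd).const_mul _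
    rw [mul_zero] at hlim
    refine ge_of_tendsto' hlim fun n => (key n).trans ?_
    have hle : cantorProd q n ≤ cantorProd q (n + 1) := by
      rw [cantorProd_succ]
      nlinarith [hq.two_le_cast n, hQ n]
    calc C * cantorProd q n ^ (1 - r) * (h + 2 / cantorProd q (n + 1))
        ≤ C * cantorProd q n ^ (1 - r) * (2 / cantorProd q n) := by
          rw [← h0, zero_add]
          have := Real.rpow_nonneg (hQ n).le (1 - r)
          exact mul_le_mul_of_nonneg_left (div_le_div_of_nonneg_left (by norm_num) (hQ n) hle)
            (by positivity)
      _ = 2 * C * cantorProd q n ^ (-r) := by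
          rw [sub_eq_add_neg, Real.rpow_add (hQ n), Real.rpow_one]
          have := (hQ n).ne'
          field_simp
  · have hlt : h < 1 := by
      have h1 := hq.cantorPoint_mem (hd z hz)
      have h2 := hq.cantorPoint_mem (hd z' (hz.trans hzz))
      rw [hh, abs_lt]
      constructor <;> linarith [h1.1, h1.2, h2.1, h2.2]
    have hex : ∃ n, h⁻¹ < cantorProd q n :=
      (hq.tendsto_cantorProd.eventually_gt_atTop _).exists
    classical
    obtain ⟨n, hn⟩ : ∃ n, Nat.find hex = n + 1 := by
      refine Nat.exists_eq_succ_of_ne_zero fun h0 => ?_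
      have := Nat.find_spec hex
      rw [h0, cantorProd_zero] at this
      have := (one_lt_inv₀ hpos).2 hlt
      linarith
    have h1 : h⁻¹ < cantorProd q (n + 1) := hn ▸ Nat.find_spec hex
    have h2 : cantorProd q n ≤ h⁻¹ := not_lt.1 (Nat.find_min hex (m := n) (by omega))
    have h3 : 2 / cantorProd q (n + 1) ≤ 2 * h := by
      rw [div_le_iff₀ (hQ _)]
      have := mul_lt_mul_of_pos_left h1 hpos
      rw [mul_inv_cancel₀ hpos.ne'] at this
      nlinarith
    calc z' - z ≤ C * cantorProd q n ^ (1 - r) * (h + 2 / cantorProd q (n + 1)) := key n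
      _ ≤ C * h⁻¹ ^ (1 - r) * (3 * h) := by
          have := Real.rpow_le_rpow (hQ n).le h2 (by linarith : 0 ≤ 1 - r)
          have h5 := Real.rpow_nonneg (hQ n).le (1 - r)
          have h6 := Real.rpow_nonneg (inv_nonneg.2 hh0) (1 - r)
          refine mul_le_mul (mul_le_mul_of_nonneg_left this hC0.le) (by linarith) ?_ (by positivity)
          have := hQ (n + 1)
          positivity
      _ = 3 * C * h ^ r := by
          rw [Real.inv_rpow hh0, ← Real.rpow_neg hh0, neg_sub, Real.rpow_sub hpos, Real.rpow_one]
          field_simp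

/-- A set that contains all points with digits in windows of relative size `q^{o(1)}` has Hausdorff
dimension at least `1`. -/
theorem one_le_dimH_of_windows (hq : IsBasicSequence q) (hw : ∀ n, 1 ≤ w n)
    (haw : ∀ n, a n + w n + 1 ≤ q (n + 1))
    (hgrowth : ∀ ε : ℝ, 0 < ε → ∃ C : ℝ, ∀ n, cantorProd q (n + 1) ≤
      C * cantorProd q n ^ ε * ∏ i ∈ Finset.range (n + 1), (w i : ℝ))
    {A : Set ℝ} (hA : ∀ d : ℕ → ℕ, (∀ n, a n ≤ d n ∧ d n < a n + w n) → cantorPoint q d ∈ A) :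
    1 ≤ dimH A := by
  have hI : dimH (Set.Ico (0 : ℝ) 1) = 1 := by
    rw [Real.dimH_of_nonempty_interior (by simp)]
    simp
  refine ENNReal.le_of_forall_nnreal_lt fun r hr => ?_
  have hr1 : (r : ℝ) < 1 := by exact_mod_cast hr
  rcases eq_or_ne r 0 with rfl | hr0
  · simp
  have hr0' : 0 < r := pos_iff_ne_zero.2 hr0
  obtain ⟨C, hC⟩ := hgrowth (1 - r) (by linarith)
  set φ : ℝ → ℝ := fun z => cantorPoint q (windowDigit a w z) with hφ
  have hbound : ∀ z ∈ Set.Ico (0 : ℝ) 1, ∀ z' ∈ Set.Ico (0 : ℝ) 1,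
      |z - z'| ≤ 3 * C * |φ z - φ z'| ^ (r : ℝ) := by
    intro z hz z' hz'
    rcases le_total z z' with h | h
    · rw [abs_sub_comm, abs_of_nonneg (by linarith)]
      exact exists_holder_bound hq hw haw hr1 hC hz.1 h hz'.2 (by exact_mod_cast hr0')
    · rw [abs_of_nonneg (by linarith), abs_sub_comm (φ z)]
      exact exists_holder_bound hq hw haw hr1 hC hz'.1 h hz.2 (by exact_mod_cast hr0')
  have hinj : Set.InjOn φ (Set.Ico 0 1) := by
    intro z hz z' hz' h
    have := hbound z hz z' hz'
    rw [h, sub_self, abs_zero, Real.zero_rpow (by exact_mod_cast hr0), mul_zero] at this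
    exact sub_eq_zero.1 (abs_nonpos_iff.1 this)
  -- The decoding map is `r`-Hölder and its image `[0, 1)` has dimension 1, so its domain has
  -- dimension at least `r`.
  set g := Function.invFunOn φ (Set.Ico 0 1) with hg
  have hgl : ∀ z ∈ Set.Ico (0 : ℝ) 1, g (φ z) = z := fun z hz => hinj.leftInvOn_invFunOn hz
  have hhold : HolderOnWith (3 * C).toNNReal r g (φ '' Set.Ico 0 1) := by
    rintro _ ⟨z, hz, rfl⟩ _ ⟨z', hz', rfl⟩
    rw [hgl z hz, hgl z' hz', edist_dist, edist_dist,
      ENNReal.ofReal_rpow_of_nonneg dist_nonneg (NNReal.coe_nonneg r), ← ENNReal.ofReal_coe_nnreal,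
      ← ENNReal.ofReal_mul (NNReal.coe_nonneg _)]
    refine ENNReal.ofReal_le_ofReal ?_
    rw [Real.dist_eq, Real.dist_eq]
    exact (hbound z hz z' hz').trans (mul_le_mul_of_nonneg_right (Real.le_coe_toNNReal _)
      (Real.rpow_nonneg (abs_nonneg _) _))
  have hdim := hhold.dimH_image_le hr0'
  have himg : g '' (φ '' Set.Ico 0 1) = Set.Ico 0 1 := by
    rw [Set.image_image]
    exact (Set.image_congr hgl).trans (Set.image_id' _)
  rw [himg, hI, ENNReal.le_div_iff_mul_le (Or.inl (by exact_mod_cast hr0)) (Or.inl (by simp)),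
    one_mul] at hdim
  refine hdim.trans (dimH_mono ?_)
  rintro _ ⟨z, hz, rfl⟩
  exact hA _ fun n => ⟨le_windowDigit n, windowDigit_lt hw hz.1 n⟩

/-- Multiply the local estimates: the factors `q n ^ ε` build up `cantorProd q n ^ ε`, and the
finitely many exceptional indices go into `C`. -/
lemma cantorProd_growth (hq : IsBasicSequence q) (hw : ∀ n, 1 ≤ w n) {ε : ℝ} (hε : 0 < ε)
    (h : ∀ᶠ n in atTop, (q (n + 1) : ℝ) ≤ (q n : ℝ) ^ ε * w n) :
    ∃ C : ℝ, ∀ n, cantorProd q (n + 1) ≤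
      C * cantorProd q n ^ ε * ∏ i ∈ Finset.range (n + 1), (w i : ℝ) := by
  obtain ⟨N, hN⟩ := eventually_atTop.1 h
  have hQ := hq.cantorProd_pos
  have hmono : Monotone (cantorProd q) := monotone_nat_of_le_succ fun n => by
    rw [cantorProd_succ]
    nlinarith [hq.two_le_cast n, hQ n]
  refine ⟨cantorProd q (N + 1), fun n => ?_⟩
  have hsmall : ∀ n ≤ N, cantorProd q (n + 1) ≤
      cantorProd q (N + 1) * cantorProd q n ^ ε * ∏ i ∈ Finset.range (n + 1), (w i : ℝ) := by
    intro n hn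
    have h1 : 1 ≤ cantorProd q n ^ ε := Real.one_le_rpow (hq.one_le_cantorProd n) hε.le
    have h2 : 1 ≤ ∏ i ∈ Finset.range (n + 1), (w i : ℝ) := by
      exact_mod_cast Nat.succ_le_of_lt (Finset.prod_pos fun i _ => hw i)
    have h3 : cantorProd q (n + 1) ≤ cantorProd q (N + 1) := hmono (by omega)
    have h4 := hQ (N + 1)
    calc cantorProd q (n + 1) ≤ cantorProd q (N + 1) := h3
      _ ≤ cantorProd q (N + 1) * cantorProd q n ^ ε := le_mul_of_one_le_right h4.le h1
      _ ≤ _ := le_mul_of_one_le_right (by positivity) h2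
  induction n with
  | zero => exact hsmall 0 (Nat.zero_le _)
  | succ n ih =>
    rcases le_or_gt (n + 1) N with hn | hn
    · exact hsmall _ hn
    · have h1 := hN (n + 1) hn.le
      have h2 : (0 : ℝ) ≤ q (n + 1 + 1) := Nat.cast_nonneg _
      have h3 : cantorProd q (n + 1) ^ ε = cantorProd q n ^ ε * (q (n + 1) : ℝ) ^ ε := by
        rw [cantorProd_succ, Real.mul_rpow (hQ n).le (Nat.cast_nonneg _)]
      rw [cantorProd_succ q (n + 1), Finset.prod_range_succ, h3]
      have h4 := Real.rpow_nonneg (hQ n).le ε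
      have h5 := hQ (N + 1)
      have h6 : 0 ≤ ∏ i ∈ Finset.range (n + 1), (w i : ℝ) :=
        Finset.prod_nonneg fun _ _ => Nat.cast_nonneg _
      calc cantorProd q (n + 1) * q (n + 1 + 1) ≤
          (cantorProd q (N + 1) * cantorProd q n ^ ε * ∏ i ∈ Finset.range (n + 1), (w i : ℝ)) *
            ((q (n + 1) : ℝ) ^ ε * w (n + 1)) := mul_le_mul ih h1 h2 (by positivity)
        _ = _ := by ring

end

/-! ### Level windows and discrete imitation of a distribution function. -/

/-- The interval `[α, β)` is adjacent to the point `s` where `F` passes the level `y`, on the side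
for which membership of `[α, β)` tells whether `F` has reached `y` at `s`. -/
structure IsLevelWindow (F : ℝ → ℝ) (y s α β : ℝ) : Prop where
  lt : α < β
  side : s = α ∧ F s < y ∨ s = β ∧ y ≤ F s
  below : ∀ t < s, F t < y
  above : ∀ t > s, y ≤ F t

/-- Let `s` be the infimum of the points where `F` is at least `y`. The window lies to the left of
`s` if the infimum is attained and to the right if not; then at `t = s` the conditions `x < t` and
`y ≤ F t` agree for every `x` in the window. -/
lemma exists_isLevelWindow {F : ℝ → ℝ} (hF : Monotone F) (h0 : ∀ t ≤ 0, F t = 0)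
    (h1 : ∀ t, 1 ≤ t → F t = 1) {y η : ℝ} (hy0 : 0 < y) (hy1 : y ≤ 1) (hη : 0 < η) :
    ∃ s α β, IsLevelWindow F y s α β ∧ 0 ≤ α ∧ β ≤ 1 ∧ β - α ≤ η := by
  set A := {t | y ≤ F t} with hA
  have hne : (1 : ℝ) ∈ A := by simp [hA, h1 1 le_rfl, hy1]
  have hpos : ∀ t ∈ A, 0 < t := fun t ht => by
    by_contra hcon
    have := h0 t (not_lt.1 hcon)
    have : y ≤ F t := ht
    linarith
  have hbdd : BddBelow A := ⟨0, fun t ht => (hpos t ht).le⟩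
  set s := sInf A with hs
  have hbelow : ∀ t < s, F t < y := fun t ht => not_le.1 (notMem_of_lt_csInf (s := A) ht hbdd)
  have habove : ∀ t > s, y ≤ F t := fun t ht => by
    obtain ⟨u, hu, hut⟩ := exists_lt_of_csInf_lt ⟨1, hne⟩ ht
    exact le_trans hu (hF hut.le)
  have hs0 : 0 ≤ s := le_csInf ⟨1, hne⟩ fun t ht => (hpos t ht).le
  have hs1 : s ≤ 1 := csInf_le hbdd hne
  by_cases hy : y ≤ F s
  · have := hpos s hy
    refine ⟨s, max 0 (s - η), s, ⟨?_, Or.inr ⟨rfl, hy⟩, hbelow, habove⟩, le_max_left _ _, hs1, ?_⟩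
    · exact max_lt this (by linarith)
    · linarith [le_max_right 0 (s - η)]
  · have : s < 1 := lt_of_le_of_ne hs1 fun h => hy (by rw [h, h1 1 le_rfl]; exact hy1)
    refine ⟨s, s, min 1 (s + η), ⟨?_, Or.inl ⟨rfl, not_le.1 hy⟩, hbelow, habove⟩, hs0,
      min_le_left _ _, ?_⟩
    · exact lt_min this (by linarith)
    · linarith [min_le_right 1 (s + η)]

/-- The number of the levels `1/L, …, L/L` that are at most `c` is `⌊c L⌋`. -/
lemma sum_levels (L : ℕ) {c : ℝ} (h0 : 0 ≤ c) (h1 : c ≤ 1) :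
    ∑ j ∈ Finset.range L, (if ((j : ℝ) + 1) / L ≤ c then (1 : ℝ) else 0) = ⌊c * L⌋₊ := by
  rw [← Finset.sum_filter, Finset.sum_const, nsmul_eq_mul, mul_one]
  congr 1
  rw [← Finset.card_range ⌊c * L⌋₊]
  congr 1
  ext j
  simp only [Finset.mem_filter, Finset.mem_range]
  have hcL : ⌊c * L⌋₊ ≤ L := by
    refine Nat.floor_le_of_le ?_
    have : (0 : ℝ) ≤ L := Nat.cast_nonneg _
    nlinarith
  constructor
  · rintro ⟨hj, h⟩
    have : (0 : ℝ) < L := by exact_mod_cast (Nat.zero_le j).trans_lt hj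
    rw [div_le_iff₀ this] at h
    exact Nat.le_floor (by push_cast; exact h)
  · intro hj
    have hjL := hj.trans_le hcL
    have : (0 : ℝ) < L := by exact_mod_cast (Nat.zero_le j).trans_lt hjL
    refine ⟨hjL, ?_⟩
    rw [div_le_iff₀ this]
    have h2 : ((j + 1 : ℕ) : ℝ) ≤ ⌊c * L⌋₊ := by exact_mod_cast hj
    push_cast at h2
    exact h2.trans (Nat.floor_le (by positivity))

/-- A term can be counted too early only when its window ends at `s` and `s - η < t < s`. Then `F`
passes `y` strictly after `t`, so the correction can start from the right limit at `t` and a jump at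
`t` costs nothing. `IsLevelWindow.le_indicator` is the mirror image, for windows that begin at `s`.
-/
lemma IsLevelWindow.indicator_le {F : ℝ → ℝ} {y s α β η x t : ℝ} (h : IsLevelWindow F y s α β)
    (hF : Monotone F) (hη : 0 < η) (hlen : β - α ≤ η) (hx : x ∈ Set.Ico α β) :
    (if x < t then (1 : ℝ) else 0) ≤ (if y ≤ F t then 1 else 0) +
      (if y ≤ F (t + η) then 1 else 0) - (if y ≤ Function.rightLim F t then 1 else 0) := by
  have h1 : F t ≤ Function.rightLim F t := hF.le_rightLim le_rfl
  have h2 : Function.rightLim F t ≤ F (t + η) := hF.rightLim_le (by linarith)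
  by_cases hy : y ≤ F t
  · rw [if_pos hy, if_pos (hy.trans h1), if_pos (hy.trans (h1.trans h2))]
    split_ifs <;> norm_num
  · rw [if_neg hy]
    by_cases hxt : x < t
    · have hts : t ≤ s := not_lt.1 fun hc => hy (h.above t hc)
      rcases h.side with ⟨rfl, _⟩ | ⟨rfl, hs⟩
      · linarith [hx.1]
      · have hlt : t < s := lt_of_le_of_ne hts fun hc => hy (hc ▸ hs)
        have h3 : y ≤ F (t + η) := h.above _ (by linarith [hx.1])
        have h4 : Function.rightLim F t < y :=
          (hF.rightLim_le (show t < (t + s) / 2 by linarith)).trans_lt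
            (h.below _ (by linarith))
        rw [if_pos h3, if_neg (not_le.2 h4)]
        split_ifs; norm_num
    · rw [if_neg hxt]
      by_cases h3 : y ≤ Function.rightLim F t
      · rw [if_pos h3, if_pos (h3.trans h2)]; norm_num
      · rw [if_neg h3]
        split_ifs <;> norm_num

lemma IsLevelWindow.le_indicator {F : ℝ → ℝ} {y s α β η x t : ℝ} (h : IsLevelWindow F y s α β)
    (hF : Monotone F) (hη : 0 < η) (hlen : β - α ≤ η) (hx : x ∈ Set.Ico α β) :
    (if y ≤ F t then 1 else 0) + (if y ≤ F (t - η) then 1 else 0) -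
      (if y ≤ Function.leftLim F t then 1 else 0) ≤ (if x < t then (1 : ℝ) else 0) := by
  have h1 : Function.leftLim F t ≤ F t := hF.leftLim_le le_rfl
  have h2 : F (t - η) ≤ Function.leftLim F t := hF.le_leftLim (by linarith)
  by_cases hy : y ≤ F t
  · rw [if_pos hy]
    by_cases hxt : x < t
    · rw [if_pos hxt]
      by_cases h3 : y ≤ F (t - η)
      · rw [if_pos h3, if_pos (h3.trans h2)]; norm_num
      · rw [if_neg h3]
        split_ifs <;> norm_num
    · have hst : s ≤ t := not_lt.1 fun hc => (h.below t hc).not_ge hy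
      rcases h.side with ⟨rfl, hs⟩ | ⟨rfl, _⟩
      · have hlt : s < t := lt_of_le_of_ne hst fun hc => hs.not_ge (hc ▸ hy)
        have h3 : F (t - η) < y := h.below _ (by linarith [hx.2])
        have h4 : y ≤ Function.leftLim F t :=
          (h.above ((s + t) / 2) (by linarith)).trans (hF.le_leftLim (by linarith))
        rw [if_pos h4, if_neg (not_le.2 h3)]
        split_ifs; norm_num
      · linarith [hx.2]
  · rw [if_neg hy, if_neg fun hc => hy (hc.trans (h2.trans h1)), if_neg fun hc => hy (hc.trans h1)]
    split_ifs <;> norm_num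

/-- A bound for the variation of `F` close to `t`, but not at `t`. -/
noncomputable def nearVariation (F : ℝ → ℝ) (t η : ℝ) : ℝ :=
  (Function.leftLim F t - F (t - η)) + (F (t + η) - Function.rightLim F t)

/-- Sum the indicator bounds over the levels; each sum is a count `⌊c L⌋`, and the 3 covers the
rounding of three such counts. -/
lemma abs_sum_indicator_sub_le {F : ℝ → ℝ} (hF : Monotone F) (hF0 : ∀ t, 0 ≤ F t)
    (hF1 : ∀ t, F t ≤ 1) {η : ℝ} (hη : 0 < η) (L : ℕ) (x : ℕ → ℝ)
    (h : ∀ j < L, ∃ s α β, IsLevelWindow F (((j : ℝ) + 1) / L) s α β ∧ β - α ≤ η ∧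
      x j ∈ Set.Ico α β) (t : ℝ) :
    |∑ j ∈ Finset.range L, (if x j < t then (1 : ℝ) else 0) - L * F t|
      ≤ L * nearVariation F t η + 3 := by
  have hfl : ∀ c : ℝ, 0 ≤ c → c ≤ 1 → c * L - 1 <
      ∑ j ∈ Finset.range L, (if ((j : ℝ) + 1) / L ≤ c then (1 : ℝ) else 0) ∧
      ∑ j ∈ Finset.range L, (if ((j : ℝ) + 1) / L ≤ c then (1 : ℝ) else 0) ≤ c * L := by
    intro c hc0 hc1
    rw [sum_levels L hc0 hc1]
    exact ⟨Nat.sub_one_lt_floor _, Nat.floor_le (by positivity)⟩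
  have r1 : F t ≤ Function.rightLim F t := hF.le_rightLim le_rfl
  have r2 : Function.rightLim F t ≤ F (t + η) := hF.rightLim_le (by linarith)
  have l1 : Function.leftLim F t ≤ F t := hF.leftLim_le le_rfl
  have l2 : F (t - η) ≤ Function.leftLim F t := hF.le_leftLim (by linarith)
  have hL : (0 : ℝ) ≤ L := Nat.cast_nonneg _
  have up : ∑ j ∈ Finset.range L, (if x j < t then (1 : ℝ) else 0) ≤
      ∑ j ∈ Finset.range L, ((if ((j : ℝ) + 1) / L ≤ F t then (1 : ℝ) else 0) +
        (if ((j : ℝ) + 1) / L ≤ F (t + η) then 1 else 0) -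
        (if ((j : ℝ) + 1) / L ≤ Function.rightLim F t then 1 else 0)) := by
    refine Finset.sum_le_sum fun j hj => ?_
    obtain ⟨s, α, β, hw, hlen, hx⟩ := h j (Finset.mem_range.1 hj)
    exact hw.indicator_le hF hη hlen hx
  have low : ∑ j ∈ Finset.range L, ((if ((j : ℝ) + 1) / L ≤ F t then (1 : ℝ) else 0) +
        (if ((j : ℝ) + 1) / L ≤ F (t - η) then 1 else 0) -
        (if ((j : ℝ) + 1) / L ≤ Function.leftLim F t then 1 else 0)) ≤
      ∑ j ∈ Finset.range L, (if x j < t then (1 : ℝ) else 0) := by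
    refine Finset.sum_le_sum fun j hj => ?_
    obtain ⟨s, α, β, hw, hlen, hx⟩ := h j (Finset.mem_range.1 hj)
    exact hw.le_indicator hF hη hlen hx
  rw [Finset.sum_sub_distrib, Finset.sum_add_distrib] at up low
  have e1 := hfl (F t) (hF0 t) (hF1 t)
  have e2 := hfl (F (t + η)) (hF0 _) (hF1 _)
  have e3 := hfl (F (t - η)) (hF0 _) (hF1 _)
  have e4 := hfl (Function.rightLim F t) ((hF0 t).trans r1) (r2.trans (hF1 _))
  have e5 := hfl (Function.leftLim F t) ((hF0 _).trans l2) (l1.trans (hF1 _))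
  have f1 := mul_le_mul_of_nonneg_right l2 hL
  have f2 := mul_le_mul_of_nonneg_right r2 hL
  have hexp : L * nearVariation F t η = Function.leftLim F t * L - F (t - η) * L +
      (F (t + η) * L - Function.rightLim F t * L) := by
    unfold nearVariation
    ring
  rw [abs_le, hexp]
  constructor <;> linarith [e1.1, e1.2, e2.1, e2.2, e3.1, e3.2, e4.1, e4.2, e5.1, e5.2]

lemma tendsto_nearVariation {F : ℝ → ℝ} (hF : Monotone F) (t : ℝ) {η : ℕ → ℝ}
    (hpos : ∀ k, 0 < η k) (hη : Tendsto η atTop (𝓝 0)) :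
    Tendsto (fun k => nearVariation F t (η k)) atTop (𝓝 0) := by
  have h1 : Tendsto (fun k => t - η k) atTop (𝓝[<] t) := by
    refine tendsto_nhdsWithin_iff.2 ⟨by simpa using hη.const_sub t, Eventually.of_forall fun k => ?_⟩
    have := hpos k
    simp [this]
  have h2 : Tendsto (fun k => t + η k) atTop (𝓝[>] t) := by
    refine tendsto_nhdsWithin_iff.2 ⟨by simpa using hη.const_add t, Eventually.of_forall fun k => ?_⟩
    have := hpos k
    simp [this]
  have h3 := ((hF.tendsto_leftLim t).comp h1).const_sub (Function.leftLim F t)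
  have h4 := ((hF.tendsto_rightLim t).comp h2).sub_const (Function.rightLim F t)
  simpa [nearVariation] using h3.add h4

/-- One-sided limits commute with finite sums. This controls a growing number of functions by a
single fixed one, so no uniformity over the family is needed. -/
lemma sum_nearVariation {ι : Type*} (I : Finset ι) (F : ι → ℝ → ℝ) {G : ℝ → ℝ} {c : ℝ}
    (hF : ∀ i ∈ I, Monotone (F i)) (hG : Monotone G) (h : ∀ t, ∑ i ∈ I, F i t = c * G t)
    (t η : ℝ) : ∑ i ∈ I, nearVariation (F i) t η = c * nearVariation G t η := by
  have hl : ∑ i ∈ I, Function.leftLim (F i) t = c * Function.leftLim G t := by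
    refine tendsto_nhds_unique (f := fun u => ∑ i ∈ I, F i u) (l := 𝓝[<] t)
      (tendsto_finsetSum _ fun i hi => (hF i hi).tendsto_leftLim t) ?_
    simp only [h]
    exact (hG.tendsto_leftLim t).const_mul c
  have hr : ∑ i ∈ I, Function.rightLim (F i) t = c * Function.rightLim G t := by
    refine tendsto_nhds_unique (f := fun u => ∑ i ∈ I, F i u) (l := 𝓝[>] t)
      (tendsto_finsetSum _ fun i hi => (hF i hi).tendsto_rightLim t) ?_
    simp only [h]
    exact (hG.tendsto_rightLim t).const_mul c
  simp only [nearVariation, Finset.sum_add_distrib, Finset.sum_sub_distrib, h, hl, hr]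
  ring

/-! ### Averages along stages. -/

/-- A sequence whose sums over long periods are small, the periods being short compared with their
position, has averages tending to `0`. -/
lemma tendsto_average_zero {a : ℕ → ℝ} (ha : ∀ n, |a n| ≤ 1) {s p : ℕ → ℕ} {err : ℕ → ℝ} {K : ℕ}
    (hs : Monotone s) (hst : Tendsto s atTop atTop) (hp : ∀ k ≥ K, 0 < p k) (hdvd : ∀ k ≥ K, p k ∣ s k)
    (hdvd' : ∀ k ≥ K, p k ∣ s (k + 1)) (hps : ∀ k ≥ K, (k + 1) * p k ≤ s k)
    (hsum : ∀ k ≥ K, ∀ x, s k ≤ x * p k → (x + 1) * p k ≤ s (k + 1) →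
      |∑ i ∈ Finset.range (p k), a (x * p k + i)| ≤ err k * p k)
    (herr : Tendsto err atTop (𝓝 0)) :
    Tendsto (fun n : ℕ => (∑ i ∈ Finset.range n, a i) / n) atTop (𝓝 0) := by
  rw [Metric.tendsto_atTop]
  intro ε hε
  have hinv : Tendsto (fun k : ℕ => 1 / ((k : ℝ) + 1)) atTop (𝓝 0) :=
    tendsto_one_div_add_atTop_nhds_zero_nat
  obtain ⟨K', hK'⟩ := eventually_atTop.1 (((herr.eventually_lt_const (show 0 < ε / 4 by linarith)).and
    (hinv.eventually_lt_const (show 0 < ε / 4 by linarith))).and (eventually_ge_atTop K))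
  have habs : ∀ n, |∑ i ∈ Finset.range n, a i| ≤ n := fun n =>
    (Finset.abs_sum_le_sum_abs _ _).trans
      ((Finset.sum_le_sum fun i _ => ha i).trans (by simp))
  obtain ⟨C, hC⟩ : ∃ C : ℝ, C = s K' := ⟨_, rfl⟩
  -- The two divisibilities mean that whole periods tile stage `k` exactly. The bound spreads period
  -- by period, then from stage to stage; `C = s K'` pays for the beginning.
  have step : ∀ k ≥ K', |∑ i ∈ Finset.range (s k), a i| ≤ C + ε / 4 * s k →
      ∀ y, s k ≤ y * p k → y * p k ≤ s (k + 1) →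
        |∑ i ∈ Finset.range (y * p k), a i| ≤ C + ε / 4 * (y * p k : ℕ) := by
    intro k hk hbase y hy
    obtain ⟨z, hz⟩ := hdvd k (hK' k hk).2
    have hpk := hp k (hK' k hk).2
    rw [mul_comm] at hz
    have hzy : z ≤ y := by
      rw [hz] at hy
      exact Nat.le_of_mul_le_mul_right hy hpk
    clear hy
    induction y, hzy using Nat.le_induction with
    | base => intro _; rw [← hz]; exact hbase
    | succ y hzy ih =>
      intro hy
      have h1 := ih (le_trans (Nat.mul_le_mul_right _ (Nat.le_succ y)) hy)
      have h2 := hsum k (hK' k hk).2 y (by rw [hz]; exact Nat.mul_le_mul_right _ hzy) hy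
      have h3 := (hK' k hk).1.1
      rw [Nat.succ_mul, Finset.sum_range_add]
      have h4 : err k * p k ≤ ε / 4 * p k :=
        mul_le_mul_of_nonneg_right h3.le (Nat.cast_nonneg _)
      refine (abs_add_le _ _).trans ?_
      push_cast at h1 ⊢
      nlinarith
  have hbase : ∀ k ≥ K', |∑ i ∈ Finset.range (s k), a i| ≤ C + ε / 4 * s k := by
    intro k hk
    induction k, hk using Nat.le_induction with
    | base =>
      have : 0 ≤ ε / 4 * (s K' : ℝ) := by positivity
      linarith [habs (s K')]
    | succ k hk ih =>
      obtain ⟨z, hz⟩ := hdvd' k (hK' k hk).2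
      rw [mul_comm] at hz
      have := step k hk ih z (hz ▸ hs (Nat.le_succ k)) hz.ge
      rwa [← hz] at this
  have hmain : ∀ n ≥ s K', |∑ i ∈ Finset.range n, a i| ≤ C + ε / 2 * n := by
    intro n hn
    obtain ⟨k, hk, hkn, hnk⟩ : ∃ k ≥ K', s k ≤ n ∧ n < s (k + 1) := by
      have hex : ∃ k, n < s (k + 1) :=
        (((tendsto_add_atTop_iff_nat 1).2 hst).eventually_gt_atTop n).exists
      classical
      have h1 := Nat.find_spec hex
      have h3 : K' ≤ Nat.find hex := by
        by_contra hcon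
        have := hs (show Nat.find hex + 1 ≤ K' by omega)
        omega
      refine ⟨Nat.find hex, h3, ?_, h1⟩
      rcases h3.eq_or_lt with h | h
      · rw [← h]; exact hn
      · have h2 := Nat.find_min hex (m := Nat.find hex - 1) (by omega)
        rw [Nat.sub_add_cancel (by omega)] at h2
        omega
    have hpk := hp k (hK' k hk).2
    obtain ⟨z, hz⟩ := hdvd k (hK' k hk).2
    rw [mul_comm] at hz
    have hdm := Nat.div_add_mod n (p k)
    have hml := Nat.mod_lt n hpk
    have hlow : s k ≤ n / p k * p k := by
      rw [hz]
      exact Nat.mul_le_mul_right _ ((Nat.le_div_iff_mul_le hpk).2 (hz ▸ hkn))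
    have h1 := step k hk (hbase k hk) (n / p k) hlow
      ((Nat.div_mul_le_self _ _).trans hnk.le)
    have h2 : ∑ i ∈ Finset.range n, a i = ∑ i ∈ Finset.range (n / p k * p k), a i +
        ∑ i ∈ Finset.range (n % p k), a (n / p k * p k + i) := by
      rw [← Finset.sum_range_add, mul_comm, hdm]
    have h3 : |∑ i ∈ Finset.range (n % p k), a (n / p k * p k + i)| ≤ p k :=
      (Finset.abs_sum_le_sum_abs _ _).trans ((Finset.sum_le_sum fun i _ => ha _).trans (by
        simpa using hml.le))
    -- The incomplete last period is at most `n / (k + 1)`, which costs the second `ε / 4`.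
    have h4 : (p k : ℝ) ≤ ε / 4 * n := by
      have h5 : ((k : ℝ) + 1) * p k ≤ n := by
        exact_mod_cast (hps k (hK' k hk).2).trans hkn
      have h6 := (hK' k hk).1.2
      have h7 : (0 : ℝ) < (k : ℝ) + 1 := by positivity
      rw [div_lt_iff₀ h7] at h6
      have h8 : (0 : ℝ) ≤ p k := Nat.cast_nonneg _
      nlinarith
    have h9 : ((n / p k * p k : ℕ) : ℝ) ≤ n := by exact_mod_cast Nat.div_mul_le_self n (p k)
    rw [h2]
    refine (abs_add_le _ _).trans ?_
    nlinarith
  obtain ⟨N, hN⟩ := exists_nat_gt (C / (ε / 2))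
  refine ⟨max (s K') (N + 1), fun n hn => ?_⟩
  have hn1 := hmain n ((le_max_left _ _).trans hn)
  have hn2 : (N : ℝ) + 1 ≤ n := by exact_mod_cast (le_max_right _ _).trans hn
  have hn0 : (0 : ℝ) < n := by
    have : (0 : ℝ) ≤ N := Nat.cast_nonneg _
    linarith
  rw [div_lt_iff₀ (by linarith)] at hN
  rw [Real.dist_eq, sub_zero, abs_div, Nat.abs_cast, div_lt_iff₀ hn0]
  nlinarith

/-- Averages of a sequence that takes the value `c k` along the run `[s k, s (k + 1))` have
`c k` as approximate value at the end of the run. -/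
lemma tendsto_average_run {b : ℕ → ℝ} (hb : ∀ n, |b n| ≤ 1) {s : ℕ → ℕ} {c : ℝ} {κ : ℕ → ℕ}
    (hκ : Tendsto κ atTop atTop)
    (hs : ∀ᶠ k in atTop, (k + 1) * s k ≤ s (k + 1)) (hs0 : ∀ᶠ k in atTop, 0 < s k)
    (hc : ∀ᶠ k in atTop, ∀ n, s (κ k) ≤ n → n < s (κ k + 1) → b n = c) :
    Tendsto (fun k => (∑ i ∈ Finset.range (s (κ k + 1)), b i) / s (κ k + 1)) atTop (𝓝 c) := by
  have hc1 : |c| ≤ 1 := by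
    obtain ⟨k, h1, h2, h3, h4⟩ := ((hc.and ((hκ.eventually hs).and ((hκ.eventually hs0).and
      (hκ.eventually (eventually_ge_atTop 1))))).exists)
    have : s (κ k) < s (κ k + 1) := by nlinarith
    rw [← h1 _ le_rfl this]
    exact hb _
  have hlim : Tendsto (fun k => 2 * (1 / ((κ k : ℝ) + 1))) atTop (𝓝 0) := by
    have h0 : Tendsto (fun k : ℕ => 1 / ((k : ℝ) + 1)) atTop (𝓝 0) :=
      tendsto_one_div_add_atTop_nhds_zero_nat
    have h := (h0.comp hκ).const_mul 2
    rw [mul_zero] at h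
    exact h
  rw [tendsto_iff_dist_tendsto_zero]
  refine squeeze_zero' (Eventually.of_forall fun _ => dist_nonneg) ?_ hlim
  filter_upwards [hc, hκ.eventually hs, hκ.eventually hs0] with k h1 h2 h3
  have hpos : (0 : ℝ) < s (κ k + 1) := by
    have : 0 < s (κ k + 1) := by nlinarith
    exact_mod_cast this
  have hle : s (κ k) ≤ s (κ k + 1) := by nlinarith
  -- Only terms before the run deviate from `c`, and they are a proportion of at most `1 / (κ k +
  -- 1)`.
  have hsum : ∑ i ∈ Finset.range (s (κ k + 1)), b i - c * s (κ k + 1) =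
      ∑ i ∈ Finset.range (s (κ k)), (b i - c) := by
    have h4 : ∑ i ∈ Finset.range (s (κ k + 1)), (b i - c) =
        ∑ i ∈ Finset.range (s (κ k)), (b i - c) := by
      symm
      refine Finset.sum_subset (Finset.range_mono hle) fun i hi hi' => ?_
      rw [h1 i (by simpa using hi') (by simpa using hi), sub_self]
    rw [← h4, Finset.sum_sub_distrib]
    simp [mul_comm]
  have hbd : |∑ i ∈ Finset.range (s (κ k)), (b i - c)| ≤ 2 * s (κ k) := by
    refine (Finset.abs_sum_le_sum_abs _ _).trans ?_
    refine (Finset.sum_le_sum fun i _ => (abs_sub _ _).trans (add_le_add (hb i) hc1)).trans ?_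
    simp only [Finset.sum_const, Finset.card_range, nsmul_eq_mul]
    linarith
  rw [Real.dist_eq, div_sub' hpos.ne', mul_comm _ c, hsum, abs_div, abs_of_pos hpos,
    div_le_iff₀ hpos, mul_assoc]
  refine hbd.trans (mul_le_mul_of_nonneg_left ?_ (by norm_num))
  rw [one_div, inv_mul_eq_div, le_div_iff₀ (by positivity), mul_comm]
  exact_mod_cast h2

lemma limsup_eq_of_tendsto_sub {u v : ℕ → ℝ} {U : ℝ} (huv : Tendsto (fun n => u n - v n) atTop (𝓝 0))
    (hv0 : ∀ n, 0 ≤ v n) (hvU : ∀ n, v n ≤ U) {n : ℕ → ℕ} (hn : Tendsto n atTop atTop)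
    (hvn : Tendsto (fun k => v (n k)) atTop (𝓝 U)) : limsup u atTop = U := by
  have hun : Tendsto (fun k => u (n k)) atTop (𝓝 U) := by
    simpa using (huv.comp hn).add hvn
  have hup : ∀ ε > 0, ∀ᶠ n in atTop, u n ≤ U + ε := fun ε hε => by
    filter_upwards [huv.eventually_le_const hε] with k hk
    linarith [hvU k]
  have hlow : ∀ᶠ n in atTop, -1 ≤ u n := by
    filter_upwards [huv.eventually_const_le (show (-1 : ℝ) < 0 by norm_num)] with k hk
    linarith [hv0 k]
  have hbdd : IsBoundedUnder (· ≤ ·) atTop u := ⟨U + 1, by simpa using hup 1 one_pos⟩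
  have hcob : IsCoboundedUnder (· ≤ ·) atTop u :=
    IsBoundedUnder.isCoboundedUnder_le ⟨-1, by simpa using hlow⟩
  refine le_antisymm (le_of_forall_pos_le_add fun ε hε => limsup_le_of_le hcob (hup ε hε)) ?_
  refine le_of_forall_lt fun c hc => ?_
  obtain ⟨c', hc', hc'U⟩ := exists_between hc
  refine hc'.trans_le (le_limsup_of_frequently_le ?_ hbdd)
  exact hn.frequently ((hun.eventually_const_le hc'U).frequently)

lemma liminf_eq_of_tendsto_sub {u v : ℕ → ℝ} {U V : ℝ}
    (huv : Tendsto (fun n => u n - v n) atTop (𝓝 0))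
    (hvV : ∀ n, v n ≤ V) (hvU : ∀ᶠ n in atTop, U ≤ v n) {n : ℕ → ℕ} (hn : Tendsto n atTop atTop)
    (hvn : Tendsto (fun k => v (n k)) atTop (𝓝 U)) : liminf u atTop = U := by
  have hun : Tendsto (fun k => u (n k)) atTop (𝓝 U) := by
    simpa using (huv.comp hn).add hvn
  have hlow : ∀ ε > 0, ∀ᶠ n in atTop, U - ε ≤ u n := fun ε hε => by
    filter_upwards [huv.eventually_const_le (show -ε < 0 by linarith), hvU] with k hk hk'
    linarith
  have hup : ∀ᶠ n in atTop, u n ≤ V + 1 := by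
    filter_upwards [huv.eventually_le_const one_pos] with k hk
    linarith [hvV k]
  have hbdd : IsBoundedUnder (· ≥ ·) atTop u := ⟨U - 1, by simpa using hlow 1 one_pos⟩
  have hcob : IsCoboundedUnder (· ≥ ·) atTop u :=
    IsBoundedUnder.isCoboundedUnder_ge ⟨V + 1, by simpa using hup⟩
  refine le_antisymm ?_ (le_of_forall_pos_le_add fun ε hε => ?_)
  · refine le_of_forall_gt fun c hc => ?_
    obtain ⟨c', hc'U, hc'⟩ := exists_between hc
    refine (liminf_le_of_frequently_le ?_ hbdd).trans_lt hc'
    exact hn.frequently ((hun.eventually_le_const hc'U).frequently)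
  · linarith [le_liminf_of_le hcob (hlow ε hε)]

/-! ### Distribution functions on the line, and the stages. -/

/-- The extension of `f : [0,1] → [0,1]` to a function on the real line that is constant on each
side of `[0,1]`. -/
noncomputable def realExtend (f : unitInterval → unitInterval) (t : ℝ) : ℝ :=
  f (Set.projIcc 0 1 zero_le_one t)

lemma realExtend_coe (f : unitInterval → unitInterval) (t : unitInterval) :
    realExtend f t = f t := by
  simp [realExtend, Set.projIcc_val]

lemma realExtend_nonneg (f : unitInterval → unitInterval) (t : ℝ) : 0 ≤ realExtend f t :=
  (f _).2.1

lemma realExtend_le_one (f : unitInterval → unitInterval) (t : ℝ) : realExtend f t ≤ 1 :=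
  (f _).2.2

lemma Monotone.realExtend {f : unitInterval → unitInterval} (hf : Monotone f) :
    Monotone (realExtend f) := fun _ _ h => hf (Set.monotone_projIcc _ h)

lemma IsADF.realExtend_of_nonpos {f : unitInterval → unitInterval} (hf : IsADF f) {t : ℝ}
    (ht : t ≤ 0) : realExtend f t = 0 := by
  have h : Set.projIcc (0 : ℝ) 1 zero_le_one t = 0 := Set.projIcc_of_le_left _ ht
  rw [realExtend, h, hf.map_zero]
  rfl

lemma IsADF.realExtend_of_one_le {f : unitInterval → unitInterval} (hf : IsADF f) {t : ℝ}
    (ht : 1 ≤ t) : realExtend f t = 1 := by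
  have h : Set.projIcc (0 : ℝ) 1 zero_le_one t = 1 := Set.projIcc_of_right_le _ ht
  rw [realExtend, h, hf.map_one]
  rfl

/-- The family that is followed in stage `k`: the upper one for even `k`, the lower one for
odd `k`. -/
def stageFamily (fup flow : ℕ → ℕ → unitInterval → unitInterval) (k : ℕ) :
    ℕ → ℕ → unitInterval → unitInterval :=
  if Even k then fup else flow

lemma stageFamily_cases (fup flow : ℕ → ℕ → unitInterval → unitInterval) (k : ℕ) :
    stageFamily fup flow k = fup ∨ stageFamily fup flow k = flow := by
  unfold stageFamily
  split_ifs <;> simp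

lemma IsLinearFamilyADF.stageFamily {fup flow : ℕ → ℕ → unitInterval → unitInterval}
    (hup : IsLinearFamilyADF fup) (hlow : IsLinearFamilyADF flow) (k : ℕ) :
    IsLinearFamilyADF (stageFamily fup flow k) := by
  rcases stageFamily_cases fup flow k with h | h <;> rw [h] <;> assumption

lemma IsLinearFamilyADF.sum_realExtend {f : ℕ → ℕ → unitInterval → unitInterval}
    (hf : IsLinearFamilyADF f) {m r d : ℕ} (hr : r < m) (hd : 1 ≤ d) (t : ℝ) :
    ∑ i ∈ Finset.range d, realExtend (f (m * d) (m * i + r)) t = d * realExtend (f m r) t := by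
  unfold realExtend
  rw [hf.linear m r d hr hd]
  have : (d : ℝ) ≠ 0 := by positivity
  field_simp

lemma residue_lt {m r d i : ℕ} (hr : r < m) (hi : i < d) : m * i + r < m * d := by
  have : m * (i + 1) ≤ m * d := Nat.mul_le_mul_left _ hi
  rw [mul_add] at this
  omega

/-- Positions `S k` at which the stages of the construction start. Stage `k` consists of periods of
length `k! * (k + 1)`. -/
structure IsStageStarts (S : ℕ → ℕ) : Prop where
  zero : S 0 = 0
  strictMono : StrictMono S
  dvd : ∀ k, k.factorial * (k + 1) ∣ S k
  dvd_succ : ∀ k, k.factorial * (k + 1) ∣ S (k + 1)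
  period_le : ∀ k, 1 ≤ k → (k + 1) * (k.factorial * (k + 1)) ≤ S k
  ratio : ∀ k, (k + 1) * S k ≤ S (k + 1)

/-- The stage that the position `N` belongs to. -/
def stageOf (S : ℕ → ℕ) (N : ℕ) : ℕ := Nat.findGreatest (fun k => S k ≤ N) N

namespace IsStageStarts
variable {S : ℕ → ℕ} (hS : IsStageStarts S)
include hS

lemma start_le (N : ℕ) : S (stageOf S N) ≤ N := by
  have := Nat.findGreatest_spec (P := fun k => S k ≤ N) (Nat.zero_le N)
    (by rw [hS.zero]; exact Nat.zero_le N)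
  exact this

lemma lt_succ_start (N : ℕ) : N < S (stageOf S N + 1) := by
  by_contra hcon
  have h1 : stageOf S N + 1 ≤ N := (hS.strictMono.id_le _).trans (not_lt.1 hcon)
  have := Nat.le_findGreatest (P := fun k => S k ≤ N) h1 (not_lt.1 hcon)
  change stageOf S N + 1 ≤ stageOf S N at this
  omega

lemma stageOf_eq {k N : ℕ} (h1 : S k ≤ N) (h2 : N < S (k + 1)) : stageOf S N = k := by
  have h3 := hS.strictMono.lt_iff_lt.1 ((hS.start_le N).trans_lt h2)
  have h4 := hS.strictMono.lt_iff_lt.1 (h1.trans_lt (hS.lt_succ_start N))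
  omega

lemma le_stageOf {k N : ℕ} (h1 : S k ≤ N) : k ≤ stageOf S N := by
  have h4 := hS.strictMono.lt_iff_lt.1 (h1.trans_lt (hS.lt_succ_start N))
  omega

lemma dvd_start {m k : ℕ} (hm : 1 ≤ m) (hk : m ≤ k) : m ∣ S k :=
  ((Nat.dvd_factorial hm hk).trans (Dvd.intro _ rfl)).trans (hS.dvd k)

/-- For `k ≥ m` both ends of stage `k` are multiples of `m`, so along every residue class modulo `m`
the stage occupies the same range of indices. -/
lemma mem_run_iff {m r k n : ℕ} (hr : r < m) (hk : m ≤ k) :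
    (S k ≤ m * n + r ∧ m * n + r < S (k + 1)) ↔ (S k / m ≤ n ∧ n < S (k + 1) / m) := by
  obtain ⟨a, ha⟩ := hS.dvd_start (by omega) hk
  obtain ⟨b, hb⟩ := hS.dvd_start (m := m) (k := k + 1) (by omega) (by omega)
  rw [ha, hb, Nat.mul_div_cancel_left _ (by omega), Nat.mul_div_cancel_left _ (by omega)]
  constructor
  · rintro ⟨h1, h2⟩
    constructor
    · by_contra hcon
      have : m * (n + 1) ≤ m * a := Nat.mul_le_mul_left _ (by omega)
      rw [mul_add] at this
      omega
    · by_contra hcon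
      have : m * b ≤ m * n := Nat.mul_le_mul_left _ (by omega)
      omega
  · rintro ⟨h1, h2⟩
    have h3 : m * a ≤ m * n := Nat.mul_le_mul_left _ h1
    exact ⟨by omega, residue_lt hr h2⟩

end IsStageStarts

/-- In stage `k`, the term `T N` lies in a level window for the distribution function that belongs
to the residue class of `N` modulo `k!`, the levels being used cyclically. -/
def FollowsStages (S : ℕ → ℕ) (fup flow : ℕ → ℕ → unitInterval → unitInterval)
    (T : ℕ → ℝ) : Prop :=
  ∀ k, 1 ≤ k → ∀ N, S k ≤ N → N < S (k + 1) → ∃ s α β,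
    IsLevelWindow (realExtend (stageFamily fup flow k k.factorial (N % k.factorial)))
      ((((N / k.factorial % (k + 1) : ℕ) : ℝ) + 1) / ((k + 1 : ℕ) : ℝ)) s α β ∧
    β - α ≤ 1 / ((k : ℝ) + 1) ∧ T N ∈ Set.Ico α β

/-! ### Upper and lower distribution functions along residue classes. -/

lemma sum_range_mul (a : ℕ → ℝ) (L d : ℕ) :
    ∑ i ∈ Finset.range (L * d), a i =
      ∑ i ∈ Finset.range d, ∑ j ∈ Finset.range L, a (j * d + i) := by
  rw [Finset.sum_comm]
  induction L with
  | zero => simp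
  | succ L ih => rw [Nat.succ_mul, Finset.sum_range_add, ih, Finset.sum_range_succ]

section
variable {S : ℕ → ℕ} (hS : IsStageStarts S) {fup flow : ℕ → ℕ → unitInterval → unitInterval}
  (hup : IsLinearFamilyADF fup) (hlow : IsLinearFamilyADF flow) {T : ℕ → ℝ}
  (hT : FollowsStages S fup flow T)
include hS hup hlow hT

/-- Over one period of stage `k`, the terms in a residue class follow the distribution function of
that class. -/
lemma abs_period_sum_le {m r k d : ℕ} (hr : r < m) (hk : m ≤ k) (hd : k.factorial = m * d) (x : ℕ)
    (h1 : S k / m ≤ x * ((k + 1) * d)) (h2 : (x + 1) * ((k + 1) * d) ≤ S (k + 1) / m) (t : ℝ) :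
    |∑ i ∈ Finset.range ((k + 1) * d),
      ((if T (m * (x * ((k + 1) * d) + i) + r) < t then (1 : ℝ) else 0)
        - realExtend (stageFamily fup flow k m r) t)| ≤
      (nearVariation (realExtend (stageFamily fup flow k m r)) t (1 / ((k : ℝ) + 1))
        + 3 * (1 / ((k : ℝ) + 1))) * ((k + 1) * d : ℕ) := by
  have hfam := hup.stageFamily hlow k
  have hd1 : 1 ≤ d := Nat.pos_of_ne_zero fun h => by
    rw [h, mul_zero] at hd
    exact k.factorial_ne_zero hd
  set F : ℕ → ℝ → ℝ := fun i => realExtend (stageFamily fup flow k (m * d) (m * i + r)) with hF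
  have hmono : ∀ i ∈ Finset.range d, Monotone (F i) := fun i hi =>
    (hfam.isADF _ _ (residue_lt hr (Finset.mem_range.1 hi))).monotone.realExtend
  have hlin := hfam.sum_realExtend hr hd1
  rw [sum_range_mul]
  have hinner : ∀ i ∈ Finset.range d, |∑ j ∈ Finset.range (k + 1),
      (if T (m * (x * ((k + 1) * d) + (j * d + i)) + r) < t then (1 : ℝ) else 0)
        - (k + 1 : ℕ) * F i t|
      ≤ (k + 1 : ℕ) * nearVariation (F i) t (1 / ((k : ℝ) + 1)) + 3 := by
    intro i hi
    have hid := Finset.mem_range.1 hi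
    refine abs_sum_indicator_sub_le (hmono i hi) (realExtend_nonneg _) (realExtend_le_one _)
      (by positivity) (k + 1) (fun j => T (m * (x * ((k + 1) * d) + (j * d + i)) + r)) ?_ t
    intro j hj
    have hlt : j * d + i < (k + 1) * d := by
      have : (j + 1) * d ≤ (k + 1) * d := Nat.mul_le_mul_right _ hj
      rw [add_mul] at this
      omega
    have hrun := (hS.mem_run_iff (n := x * ((k + 1) * d) + (j * d + i)) hr hk).2
      ⟨by omega, by rw [add_mul] at h2; omega⟩
    obtain ⟨s, α, β, hw, hlen, hmem⟩ := hT k (by omega) _ hrun.1 hrun.2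
    -- With `k! = m d`, the index `i` determines the residue `m i + r` modulo `k!`, and `j` the
    -- level used there.
    have hN : m * (x * ((k + 1) * d) + (j * d + i)) + r =
        (m * i + r) + m * d * (x * (k + 1) + j) := by ring
    have hres := residue_lt hr hid
    have hmod : (m * (x * ((k + 1) * d) + (j * d + i)) + r) % k.factorial = m * i + r := by
      rw [hN, hd, Nat.add_mul_mod_self_left, Nat.mod_eq_of_lt hres]
    have hdiv : (m * (x * ((k + 1) * d) + (j * d + i)) + r) / k.factorial % (k + 1) = j := by
      rw [hN, hd, Nat.add_mul_div_left _ _ (by omega), Nat.div_eq_of_lt hres, zero_add,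
        mul_comm x, Nat.mul_add_mod, Nat.mod_eq_of_lt hj]
    rw [hmod, hdiv, hd] at hw
    exact ⟨s, α, β, hw, hlen, hmem⟩
  have hrew : ∑ i ∈ Finset.range d, ∑ j ∈ Finset.range (k + 1),
      ((if T (m * (x * ((k + 1) * d) + (j * d + i)) + r) < t then (1 : ℝ) else 0)
        - realExtend (stageFamily fup flow k m r) t) =
      ∑ i ∈ Finset.range d, (∑ j ∈ Finset.range (k + 1),
      (if T (m * (x * ((k + 1) * d) + (j * d + i)) + r) < t then (1 : ℝ) else 0)
        - (k + 1 : ℕ) * F i t) := by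
    simp only [Finset.sum_sub_distrib, ← Finset.mul_sum, Finset.sum_const, Finset.card_range,
      nsmul_eq_mul]
    rw [hlin]
  rw [hrew]
  refine (Finset.abs_sum_le_sum_abs _ _).trans ((Finset.sum_le_sum hinner).trans (le_of_eq ?_))
  -- The variations of the `d` functions add up to `d` times that of `f_{m,r}`; the constants `3 d`
  -- become `3 / (k + 1)` relative to the period.
  rw [Finset.sum_add_distrib, ← Finset.mul_sum, sum_nearVariation _ F hmono
    (hfam.isADF m r hr).monotone.realExtend hlin]
  have : (k : ℝ) + 1 ≠ 0 := by positivity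
  simp only [Finset.sum_const, Finset.card_range, nsmul_eq_mul]
  push_cast
  field_simp

end

section
variable {S : ℕ → ℕ} (hS : IsStageStarts S) {fup flow : ℕ → ℕ → unitInterval → unitInterval}
  (hup : IsLinearFamilyADF fup) (hlow : IsLinearFamilyADF flow) {T : ℕ → ℝ}
  (hT : FollowsStages S fup flow T)

lemma IsStageStarts.monotone_div (hS : IsStageStarts S) (m : ℕ) : Monotone fun k => S k / m :=
  fun _ _ h => Nat.div_le_div_right (hS.strictMono.monotone h)

lemma IsStageStarts.tendsto_div (hS : IsStageStarts S) {m : ℕ} (hm : 1 ≤ m) :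
    Tendsto (fun k => S k / m) atTop atTop :=
  (Nat.tendsto_div_const_atTop (by omega)).comp hS.strictMono.tendsto_atTop

include hS hup hlow hT

lemma tendsto_average_indicator_sub {m r : ℕ} (hr : r < m) (t : ℝ) :
    Tendsto (fun n : ℕ => (∑ i ∈ Finset.range n,
      ((if T (m * i + r) < t then (1 : ℝ) else 0) -
        realExtend (stageFamily fup flow (stageOf S (m * i + r)) m r) t)) / n) atTop (𝓝 0) := by
  have hdvd : ∀ k ≥ m, k.factorial = m * (k.factorial / m) := fun k hk =>
    (Nat.mul_div_cancel' (Nat.dvd_factorial (by omega) hk)).symm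
  have hinv : Tendsto (fun k : ℕ => 1 / ((k : ℝ) + 1)) atTop (𝓝 0) :=
    tendsto_one_div_add_atTop_nhds_zero_nat
  have hvar : ∀ F : ℝ → ℝ, Monotone F →
      Tendsto (fun k : ℕ => nearVariation F t (1 / ((k : ℝ) + 1))) atTop (𝓝 0) := fun F hF =>
    tendsto_nearVariation hF t (fun k => by positivity) hinv
  have hnn : ∀ F : ℝ → ℝ, Monotone F → ∀ k : ℕ, 0 ≤ nearVariation F t (1 / ((k : ℝ) + 1)) := by
    intro F hF k
    have : 0 < 1 / ((k : ℝ) + 1) := by positivity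
    have h1 : F (t - 1 / ((k : ℝ) + 1)) ≤ Function.leftLim F t := hF.le_leftLim (by linarith)
    have h2 : Function.rightLim F t ≤ F (t + 1 / ((k : ℝ) + 1)) := hF.rightLim_le (by linarith)
    unfold nearVariation
    linarith
  have mup := (hup.isADF m r hr).monotone.realExtend
  have mlow := (hlow.isADF m r hr).monotone.realExtend
  refine tendsto_average_zero (K := m) (s := fun k => S k / m)
    (p := fun k => (k + 1) * (k.factorial / m))
    -- Adding the variations of both families covers either parity of `k`.
    (err := fun k => nearVariation (realExtend (fup m r)) t (1 / ((k : ℝ) + 1)) +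
      nearVariation (realExtend (flow m r)) t (1 / ((k : ℝ) + 1)) + 3 * (1 / ((k : ℝ) + 1)))
    ?_ (hS.monotone_div m) (hS.tendsto_div (by omega)) ?_ ?_ ?_ ?_ ?_ ?_
  · intro n
    have h1 := realExtend_nonneg (stageFamily fup flow (stageOf S (m * n + r)) m r) t
    have h2 := realExtend_le_one (stageFamily fup flow (stageOf S (m * n + r)) m r) t
    rw [abs_le]
    split_ifs <;> constructor <;> linarith
  · intro k hk
    have := hdvd k hk
    exact Nat.mul_pos (by omega) (Nat.pos_of_ne_zero fun h => by
      rw [h, mul_zero] at this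
      exact k.factorial_ne_zero this)
  · intro k hk
    obtain ⟨a, ha⟩ := hS.dvd k
    refine ⟨a, Nat.div_eq_of_eq_mul_right (by omega) ?_⟩
    rw [ha]
    conv_lhs => rw [hdvd k hk]
    ring
  · intro k hk
    obtain ⟨a, ha⟩ := hS.dvd_succ k
    refine ⟨a, Nat.div_eq_of_eq_mul_right (by omega) ?_⟩
    rw [ha]
    conv_lhs => rw [hdvd k hk]
    ring
  · intro k hk
    rw [Nat.le_div_iff_mul_le (by omega)]
    refine le_trans (le_of_eq ?_) (hS.period_le k (by omega))
    conv_rhs => rw [hdvd k hk]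
    ring
  · intro k hk x h1 h2
    have h3 := abs_period_sum_le hS hup hlow hT hr hk (hdvd k hk) x h1 h2 t
    have h4 : ∑ i ∈ Finset.range ((k + 1) * (k.factorial / m)),
        ((if T (m * (x * ((k + 1) * (k.factorial / m)) + i) + r) < t then (1 : ℝ) else 0) -
        realExtend (stageFamily fup flow
          (stageOf S (m * (x * ((k + 1) * (k.factorial / m)) + i) + r)) m r) t) =
        ∑ i ∈ Finset.range ((k + 1) * (k.factorial / m)),
        ((if T (m * (x * ((k + 1) * (k.factorial / m)) + i) + r) < t then (1 : ℝ) else 0) -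
        realExtend (stageFamily fup flow k m r) t) := by
      refine Finset.sum_congr rfl fun i hi => ?_
      have hi' := Finset.mem_range.1 hi
      have hrun := (hS.mem_run_iff (n := x * ((k + 1) * (k.factorial / m)) + i) hr hk).2
        ⟨by omega, by rw [add_mul, one_mul] at h2; omega⟩
      rw [hS.stageOf_eq hrun.1 hrun.2]
    rw [h4]
    refine h3.trans (mul_le_mul_of_nonneg_right ?_ (Nat.cast_nonneg _))
    have n1 := hnn _ mup k
    have n2 := hnn _ mlow k
    rcases stageFamily_cases fup flow k with h | h <;> rw [h] <;> linarith
  · have := ((hvar _ mup).add (hvar _ mlow)).add (hinv.const_mul 3)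
    simpa using this

lemma tendsto_countIn_sub {m r : ℕ} (hr : r < m) (hT0 : ∀ n, 0 ≤ T n) (t : ℝ) :
    Tendsto (fun n : ℕ => (countIn (Set.Ico 0 t) (fun n => T (m * n + r)) n : ℝ) / n -
      (∑ i ∈ Finset.range n,
        realExtend (stageFamily fup flow (stageOf S (m * i + r)) m r) t) / n) atTop (𝓝 0) := by
  refine (tendsto_average_indicator_sub hS hup hlow hT hr t).congr fun n => ?_
  rw [Finset.sum_sub_distrib, sub_div]
  congr 2
  unfold countIn
  rw [← Finset.sum_filter, Finset.sum_const, nsmul_eq_mul, mul_one]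
  congr 2
  ext i
  simp [hT0]

omit hup hlow hT in
lemma tendsto_average_stage {m r : ℕ} (hr : r < m) (t : ℝ) {κ : ℕ → ℕ}
    (hκ : Tendsto κ atTop atTop) {f : ℕ → ℕ → unitInterval → unitInterval}
    (hf : ∀ k, stageFamily fup flow (κ k) = f) :
    Tendsto (fun k => (∑ i ∈ Finset.range (S (κ k + 1) / m),
        realExtend (stageFamily fup flow (stageOf S (m * i + r)) m r) t) /
          ((S (κ k + 1) / m : ℕ) : ℝ)) atTop (𝓝 (realExtend (f m r) t)) := by
  refine tendsto_average_run (s := fun k => S k / m) (κ := κ) (fun n => ?_) hκ ?_ ?_ ?_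
  · rw [abs_of_nonneg (realExtend_nonneg _ _)]
    exact realExtend_le_one _ _
  · filter_upwards [eventually_ge_atTop m] with k hk
    rw [Nat.le_div_iff_mul_le (by omega), mul_assoc]
    exact (Nat.mul_le_mul_left _ (Nat.div_mul_le_self _ _)).trans (hS.ratio k)
  · exact (hS.tendsto_div (by omega)).eventually_gt_atTop 0
  · filter_upwards [hκ.eventually_ge_atTop m] with k hk n h1 h2
    have hrun := (hS.mem_run_iff hr hk).2 ⟨h1, h2⟩
    rw [hS.stageOf_eq hrun.1 hrun.2, hf]

/-- The averages of the stage functions never exceed `fup` and come close to it at the ends of even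
stages. For `hasLowerADF` the odd stages play this part. -/
lemma FollowsStages.hasUpperADF (hle : ∀ m r : ℕ, r < m → ∀ t, flow m r t ≤ fup m r t)
    (hT0 : ∀ n, 0 ≤ T n) {m r : ℕ} (hr : r < m) :
    HasUpperADF (fun n => T (m * n + r)) (fup m r) := by
  intro t
  have hκ : Tendsto (fun k : ℕ => 2 * k) atTop atTop := 
    tendsto_atTop_mono (fun k => show k ≤ 2 * k by omega) tendsto_id
  have h1 := tendsto_countIn_sub hS hup hlow hT hr hT0 (t : ℝ)
  have hn : Tendsto (fun k : ℕ => S (2 * k + 1) / m) atTop atTop :=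
    (hS.tendsto_div (by omega)).comp (tendsto_atTop_mono (fun k => Nat.le_succ (2 * k)) hκ)
  have h2 := tendsto_average_stage hS (fup := fup) (flow := flow) hr (t : ℝ) (f := fup) hκ
    (fun k => if_pos (even_two_mul k))
  rw [realExtend_coe] at h2
  refine limsup_eq_of_tendsto_sub h1
    (fun n => div_nonneg (Finset.sum_nonneg fun _ _ => realExtend_nonneg _ _) (Nat.cast_nonneg _))
    (fun n => ?_) hn h2
  refine div_le_of_le_mul₀ (Nat.cast_nonneg _) (fup m r t).2.1 ?_
  refine (Finset.sum_le_card_nsmul _ _ (fup m r t : ℝ) fun i _ => ?_).trans (le_of_eq ?_)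
  · rw [realExtend_coe]
    rcases stageFamily_cases fup flow (stageOf S (m * i + r)) with h | h <;> rw [h]
    exact hle m r hr t
  · simp [mul_comm]

lemma FollowsStages.hasLowerADF (hle : ∀ m r : ℕ, r < m → ∀ t, flow m r t ≤ fup m r t)
    (hT0 : ∀ n, 0 ≤ T n) {m r : ℕ} (hr : r < m) :
    HasLowerADF (fun n => T (m * n + r)) (flow m r) := by
  intro t
  have hκ : Tendsto (fun k : ℕ => 2 * k + 1) atTop atTop :=
    tendsto_atTop_mono (fun k => show k ≤ 2 * k + 1 by omega) tendsto_id
  have h1 := tendsto_countIn_sub hS hup hlow hT hr hT0 (t : ℝ)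
  have hn : Tendsto (fun k : ℕ => S (2 * k + 1 + 1) / m) atTop atTop :=
    (hS.tendsto_div (by omega)).comp (tendsto_atTop_mono (fun k => Nat.le_succ (2 * k + 1)) hκ)
  have h2 := tendsto_average_stage hS (fup := fup) (flow := flow) hr (t : ℝ) (f := flow) hκ
    (fun k => if_neg (by simp))
  rw [realExtend_coe] at h2
  refine liminf_eq_of_tendsto_sub (V := 1) h1 (fun n => ?_) ?_ hn h2
  · refine div_le_of_le_mul₀ (Nat.cast_nonneg _) zero_le_one ?_
    refine (Finset.sum_le_card_nsmul _ _ 1 fun i _ => realExtend_le_one _ _).trans (le_of_eq ?_)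
    simp
  · filter_upwards [eventually_gt_atTop 0] with n hn
    have hn' : (0 : ℝ) < n := by exact_mod_cast hn
    rw [le_div_iff₀ hn']
    refine le_trans (le_of_eq ?_) (Finset.card_nsmul_le_sum _ _ (flow m r t : ℝ) fun i _ => ?_)
    · simp [mul_comm]
    · rw [realExtend_coe]
      rcases stageFamily_cases fup flow (stageOf S (m * i + r)) with h | h <;> rw [h]
      exact hle m r hr t

end

/-! ### Accumulation points and points of increase. -/

lemma mapClusterPt_iff_dist {u : ℕ → ℝ} {a : ℝ} :
    MapClusterPt a atTop u ↔ ∀ ε > 0, ∃ᶠ n in atTop, dist (u n) a < ε := by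
  rw [Metric.nhds_basis_ball.mapClusterPt_iff_frequently]
  simp [Metric.mem_ball]

lemma MapClusterPt.of_tendsto_sub {u v : ℕ → ℝ} {a : ℝ} (h : MapClusterPt a atTop u)
    (huv : Tendsto (fun n => u n - v n) atTop (𝓝 0)) : MapClusterPt a atTop v := by
  rw [mapClusterPt_iff_dist] at h ⊢
  intro ε hε
  refine ((h (ε / 2) (by linarith)).and_eventually
    (Metric.tendsto_nhds.1 huv (ε / 2) (by linarith))).mono fun n hn => ?_
  have h1 := hn.1
  have h2 := hn.2
  rw [Real.dist_eq, abs_lt] at *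
  constructor <;> linarith [h1.1, h1.2, h2.1, h2.2]

lemma countIn_div_mem (A : Set ℝ) (ω : ℕ → ℝ) (n : ℕ) :
    (countIn A ω n : ℝ) / n ∈ Set.Icc (0 : ℝ) 1 := by
  refine ⟨by positivity, div_le_one_of_le₀ ?_ (Nat.cast_nonneg _)⟩
  have : countIn A ω n ≤ n := by
    classical
    unfold countIn
    exact (Finset.card_filter_le _ _).trans (by simp)
  exact_mod_cast this

/-- If almost no terms lie in `[y, z)`, the two counting averages are asymptotically equal. -/
lemma countIn_le_of_eventually {ω : ℕ → ℝ} {y z : ℝ}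
    (h : ∀ᶠ n in atTop, ω n ∉ Set.Ico y z) {ε : ℝ} (hε : 0 < ε) :
    ∀ᶠ n : ℕ in atTop, (countIn (Set.Ico 0 z) ω n : ℝ) / n ≤
      (countIn (Set.Ico 0 y) ω n : ℝ) / n + ε := by
  classical
  obtain ⟨N, hN⟩ := eventually_atTop.1 h
  obtain ⟨N', hN'⟩ := exists_nat_gt (N / ε)
  filter_upwards [eventually_gt_atTop N'] with n hn
  have hn0 : (0 : ℝ) < n := by exact_mod_cast (Nat.zero_le _).trans_lt hn
  have hcard : countIn (Set.Ico 0 z) ω n ≤ countIn (Set.Ico 0 y) ω n + N := by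
    unfold countIn
    refine (Finset.card_le_card (t := ((Finset.range n).filter fun i => ω i ∈ Set.Ico 0 y) ∪
      Finset.range N) ?_).trans ((Finset.card_union_le _ _).trans (by simp))
    intro i hi
    simp only [Finset.mem_filter, Finset.mem_range, Finset.mem_union, Set.mem_Ico] at hi ⊢
    by_cases hiN : i < N
    · exact Or.inr hiN
    · have := hN i (not_lt.1 hiN)
      rw [Set.mem_Ico, not_and, not_lt] at this
      refine Or.inl ⟨hi.1, hi.2.1, ?_⟩
      by_contra hcon
      linarith [this (not_lt.1 hcon), hi.2.2]
  have h1 : (countIn (Set.Ico 0 z) ω n : ℝ) ≤ countIn (Set.Ico 0 y) ω n + N := by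
    exact_mod_cast hcard
  have h2 : (N : ℝ) ≤ ε * n := by
    rw [div_lt_iff₀ hε] at hN'
    have : (N' : ℝ) < n := by exact_mod_cast hn
    nlinarith
  rw [div_add' _ _ _ hn0.ne']
  exact div_le_div_of_nonneg_right (by linarith) hn0.le

/-- If only finitely many terms met the interval, the counts below `y` and below `z` would differ by
a bounded amount, and the upper limits could not satisfy `f y < f z`. -/
lemma HasUpperADF.frequently_mem {ω : ℕ → ℝ} {f : unitInterval → unitInterval}
    (h : HasUpperADF ω f) {y z : unitInterval} (hyz : f y < f z) :
    ∃ᶠ n in atTop, ω n ∈ Set.Ico (y : ℝ) z := by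
  by_contra hcon
  have hle := fun {ε} => countIn_le_of_eventually (ε := ε) (not_frequently.1 hcon)
  have : (f z : ℝ) ≤ f y := by
    refine le_of_forall_pos_lt_add fun ε hε => ?_
    have hy : limsup (fun n : ℕ => (countIn (Set.Ico 0 (y : ℝ)) ω n : ℝ) / n) atTop
        < f y + ε / 4 := by
      rw [h y]
      linarith
    have h1 := eventually_lt_of_limsup_lt hy
      (isBoundedUnder_of ⟨1, fun n => (countIn_div_mem _ _ n).2⟩)
    refine lt_of_le_of_lt (b := f y + ε / 2) ?_ (by linarith)
    rw [← h z]
    refine limsup_le_of_le (isCoboundedUnder_le_of_le _ fun n => (countIn_div_mem _ _ n).1) ?_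
    filter_upwards [h1, hle (show 0 < ε / 4 by linarith)] with n h2 h3
    linarith
  exact absurd hyz (not_lt.2 this)

lemma HasLowerADF.frequently_mem {ω : ℕ → ℝ} {f : unitInterval → unitInterval}
    (h : HasLowerADF ω f) {y z : unitInterval} (hyz : f y < f z) :
    ∃ᶠ n in atTop, ω n ∈ Set.Ico (y : ℝ) z := by
  by_contra hcon
  have hle := fun {ε} => countIn_le_of_eventually (ε := ε) (not_frequently.1 hcon)
  have : (f z : ℝ) ≤ f y := by
    refine le_of_forall_pos_lt_add fun ε hε => ?_
    have hz : (f z : ℝ) - ε / 4 <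
        liminf (fun n : ℕ => (countIn (Set.Ico 0 (z : ℝ)) ω n : ℝ) / n) atTop := by
      rw [h z]
      linarith
    have h1 := eventually_lt_of_lt_liminf hz
      (isBoundedUnder_of ⟨0, fun n => (countIn_div_mem _ _ n).1⟩)
    refine lt_of_le_of_lt (b := f y + ε / 2) ?_ (by linarith)
    rw [← sub_le_iff_le_add, ← h y]
    refine le_liminf_of_le (isCoboundedUnder_ge_of_le _ fun n => (countIn_div_mem _ _ n).2) ?_
    filter_upwards [h1, hle (show 0 < ε / 4 by linarith)] with n h2 h3
    linarith
  exact absurd hyz (not_lt.2 this)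

lemma IncreasingAt.mapClusterPt {ω : ℕ → ℝ} {f : unitInterval → unitInterval}
    (hω : ∀ y z : unitInterval, f y < f z → ∃ᶠ n in atTop, ω n ∈ Set.Ico (y : ℝ) z)
    {x : unitInterval} (hx : IncreasingAt f x) : MapClusterPt (x : ℝ) atTop ω := by
  rw [mapClusterPt_iff_dist]
  intro ε hε
  have hball : ∀ᶠ y in 𝓝 x, dist y x < ε := Metric.ball_mem_nhds x hε
  rcases hx with hx | hx
  · obtain ⟨y, hy, hyε⟩ := (hx.and_eventually (hball.filter_mono nhdsWithin_le_nhds)).exists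
    refine (hω y x hy).mono fun n hn => ?_
    rw [Subtype.dist_eq, Real.dist_eq, abs_lt] at hyε
    rw [Real.dist_eq, abs_lt]
    constructor <;> linarith [hn.1, hn.2]
  · obtain ⟨y, hy, hyε⟩ := (hx.and_eventually (hball.filter_mono nhdsWithin_le_nhds)).exists
    refine (hω x y hy).mono fun n hn => ?_
    rw [Subtype.dist_eq, Real.dist_eq, abs_lt] at hyε
    rw [Real.dist_eq, abs_lt]
    constructor <;> linarith [hn.1, hn.2]

lemma image_increaseSet_subset {ω : ℕ → ℝ} {f : unitInterval → unitInterval}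
    (hω : ∀ y z : unitInterval, f y < f z → ∃ᶠ n in atTop, ω n ∈ Set.Ico (y : ℝ) z) :
    ((↑) : unitInterval → ℝ) '' increaseSet f ⊆ accPoints ω := by
  rw [Set.image_subset_iff]
  have hcl : IsClosed (accPoints ω) := isClosed_setOfPred_clusterPt
  exact closure_minimal (fun x hx => IncreasingAt.mapClusterPt hω hx)
    (hcl.preimage continuous_subtype_val)

/-- `f_{m,r}` is an average of monotone functions, so strict growth of one of them is inherited. -/
lemma IsLinearFamilyADF.increasingAt {f : ℕ → ℕ → unitInterval → unitInterval}
    (hf : IsLinearFamilyADF f) {m r d i : ℕ} (hr : r < m) (hi : i < d) {x : unitInterval}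
    (hx : IncreasingAt (f (m * d) (m * i + r)) x) : IncreasingAt (f m r) x := by
  have key : ∀ y z : unitInterval, y ≤ z →
      f (m * d) (m * i + r) y < f (m * d) (m * i + r) z → f m r y < f m r z := by
    intro y z hyz h
    have hlt : (f m r y : ℝ) < f m r z := by
      rw [hf.linear m r d hr (by omega), hf.linear m r d hr (by omega)]
      have hd : (0 : ℝ) < d := by exact_mod_cast (Nat.zero_le i).trans_lt hi
      refine mul_lt_mul_of_pos_left ?_ (by positivity)
      exact Finset.sum_lt_sum (fun j hj => (hf.isADF _ _
        (residue_lt hr (Finset.mem_range.1 hj))).monotone hyz) ⟨i, Finset.mem_range.2 hi, h⟩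
    exact hlt
  rcases hx with hx | hx
  · refine Or.inl ((hx.and_eventually self_mem_nhdsWithin).mono fun y hy => ?_)
    exact key y x (le_of_lt hy.2) hy.1
  · refine Or.inr ((hx.and_eventually self_mem_nhdsWithin).mono fun y hy => ?_)
    exact key x y (le_of_lt hy.2) hy.1

/-- At `s` the function is strictly separated by the level `y` from all its values on one side, the
side on which the window lies. The levels `0 < y ≤ 1` keep `s` in `[0,1]` and ensure that this side
is nonempty. -/
lemma IsLevelWindow.exists_increasingAt {f : unitInterval → unitInterval} (hf : IsADF f)
    {y s α β : ℝ} (h : IsLevelWindow (realExtend f) y s α β) (hy0 : 0 < y) (hy1 : y ≤ 1) :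
    ∃ x : unitInterval, (x : ℝ) = s ∧ IncreasingAt f x := by
  have hs0 : 0 ≤ s := by
    by_contra hcon
    have := h.above (s / 2) (by linarith)
    rw [hf.realExtend_of_nonpos (by linarith)] at this
    linarith
  have hs1 : s ≤ 1 := by
    by_contra hcon
    have := h.below 1 (by linarith)
    rw [hf.realExtend_of_one_le le_rfl] at this
    linarith
  refine ⟨⟨s, hs0, hs1⟩, rfl, ?_⟩
  have hcoe : realExtend f s = f ⟨s, hs0, hs1⟩ := realExtend_coe f ⟨s, hs0, hs1⟩
  rcases h.side with ⟨_, hs⟩ | ⟨_, hs⟩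
  · right
    have hlt : (⟨s, hs0, hs1⟩ : unitInterval) < 1 := by
      refine lt_of_le_of_ne hs1 fun hc => ?_
      have hs' : s = 1 := congrArg Subtype.val hc
      rw [hs', hf.realExtend_of_one_le le_rfl] at hs
      linarith
    have : (𝓝[>] (⟨s, hs0, hs1⟩ : unitInterval)).NeBot := nhdsGT_neBot_of_exists_gt ⟨1, hlt⟩
    refine Eventually.frequently ?_
    filter_upwards [self_mem_nhdsWithin] with z hz
    have h1 := h.above z hz
    rw [realExtend_coe] at h1
    have h2 : (f ⟨s, hs0, hs1⟩ : ℝ) < f z := by rw [← hcoe]; linarith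
    exact h2
  · left
    have hlt : (0 : unitInterval) < ⟨s, hs0, hs1⟩ := by
      refine lt_of_le_of_ne hs0 fun hc => ?_
      have hs' : s = 0 := (congrArg Subtype.val hc).symm
      rw [hs', hf.realExtend_of_nonpos le_rfl] at hs
      linarith
    have : (𝓝[<] (⟨s, hs0, hs1⟩ : unitInterval)).NeBot := nhdsLT_neBot_of_exists_lt ⟨0, hlt⟩
    refine Eventually.frequently ?_
    filter_upwards [self_mem_nhdsWithin] with z hz
    have h1 := h.below z hz
    rw [realExtend_coe] at h1
    have h2 : (f z : ℝ) < f ⟨s, hs0, hs1⟩ := by rw [← hcoe]; linarith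
    exact h2

section
variable {S : ℕ → ℕ} (hS : IsStageStarts S) {fup flow : ℕ → ℕ → unitInterval → unitInterval}
  (hup : IsLinearFamilyADF fup) (hlow : IsLinearFamilyADF flow) {T : ℕ → ℝ}
  (hT : FollowsStages S fup flow T)
include hS hup hlow hT

lemma FollowsStages.accPoints_subset {m r : ℕ} (hr : r < m) :
    accPoints (fun n => T (m * n + r)) ⊆
      ((↑) : unitInterval → ℝ) '' (increaseSet (fup m r) ∪ increaseSet (flow m r)) := by
  intro a ha
  have hclosed : IsClosed (((↑) : unitInterval → ℝ) ''
      (increaseSet (fup m r) ∪ increaseSet (flow m r))) :=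
    ((isClosed_closure.union isClosed_closure).isCompact.image continuous_subtype_val).isClosed
  rw [← hclosed.closure_eq, Metric.mem_closure_iff]
  intro ε hε
  have hinv : Tendsto (fun k : ℕ => 1 / ((k : ℝ) + 1)) atTop (𝓝 0) :=
    tendsto_one_div_add_atTop_nhds_zero_nat
  obtain ⟨K, hK⟩ := eventually_atTop.1 (hinv.eventually_lt_const (show 0 < ε / 2 by linarith))
  obtain ⟨n, hn1, hn2⟩ := ((mapClusterPt_iff_dist.1 ha (ε / 2) (by linarith)).and_eventually
    (eventually_ge_atTop (S (max K m)))).exists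
  have hnN : S (max K m) ≤ m * n + r :=
    hn2.trans ((Nat.le_mul_of_pos_left n (by omega)).trans (Nat.le_add_right _ _))
  obtain ⟨k, hk⟩ : ∃ k, k = stageOf S (m * n + r) := ⟨_, rfl⟩
  have hkmax : max K m ≤ k := hk ▸ hS.le_stageOf hnN
  have hkK := (le_max_left K m).trans hkmax
  have hkm := (le_max_right K m).trans hkmax
  obtain ⟨s, α, β, hw, hlen, hmem⟩ := hT k (by omega) _ (hk ▸ hS.start_le _)
    (hk ▸ hS.lt_succ_start _)
  obtain ⟨d, hd⟩ := Nat.dvd_factorial (show 0 < m by omega) hkm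
  set ρ := (m * n + r) % k.factorial with hρ
  have hρlt : ρ < m * d := hd ▸ Nat.mod_lt _ k.factorial_pos
  -- As `m ∣ k!`, the class modulo `k!` refines the class of `r` modulo `m`, so the point of
  -- increase passes to `f_{m,r}`.
  have hρr : ρ % m = r := by
    rw [hρ, hd, Nat.mod_mul_right_mod, Nat.mul_add_mod, Nat.mod_eq_of_lt hr]
  have hρeq : m * (ρ / m) + r = ρ := by
    conv_rhs => rw [← Nat.div_add_mod ρ m, hρr]
  have hi : ρ / m < d := Nat.div_lt_of_lt_mul hρlt
  have hfam := hup.stageFamily hlow k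
  obtain ⟨x, hxs, hx⟩ := hw.exists_increasingAt (hfam.isADF _ _ (hd ▸ hρlt)) (by positivity) (by
    rw [div_le_one (by positivity)]
    exact_mod_cast Nat.mod_lt _ (Nat.succ_pos k))
  rw [hd, ← hρeq] at hx
  have hx' := hfam.increasingAt hr hi hx
  refine ⟨x, ⟨x, ?_, rfl⟩, ?_⟩
  · rcases stageFamily_cases fup flow k with h | h <;> rw [h] at hx'
    · exact Or.inl (subset_closure hx')
    · exact Or.inr (subset_closure hx')
  · have h1 := hK k hkK
    have h2 : |T (m * n + r) - s| ≤ β - α := by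
      have := hw.lt
      rw [abs_le]
      rcases hw.side with ⟨rfl, _⟩ | ⟨rfl, _⟩ <;> constructor <;> linarith [hmem.1, hmem.2]
    rw [Real.dist_eq, abs_lt] at hn1
    rw [abs_le] at h2
    rw [hxs, Real.dist_eq, abs_lt]
    constructor <;> linarith [h2.1, h2.2, hn1.1, hn1.2]

lemma FollowsStages.accPoints_eq (hle : ∀ m r : ℕ, r < m → ∀ t, flow m r t ≤ fup m r t)
    (hT0 : ∀ n, 0 ≤ T n) {m r : ℕ} (hr : r < m) :
    accPoints (fun n => T (m * n + r)) =
      ((↑) : unitInterval → ℝ) '' (increaseSet (fup m r) ∪ increaseSet (flow m r)) := by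
  refine (hT.accPoints_subset hS hup hlow hr).antisymm ?_
  rw [Set.image_union]
  refine Set.union_subset (image_increaseSet_subset fun y z => ?_)
    (image_increaseSet_subset fun y z => ?_)
  · exact (hT.hasUpperADF hS hup hlow hle hT0 hr).frequently_mem
  · exact (hT.hasLowerADF hS hup hlow hle hT0 hr).frequently_mem

end

lemma accPoints_congr {u v : ℕ → ℝ} (huv : Tendsto (fun n => u n - v n) atTop (𝓝 0)) :
    accPoints u = accPoints v := by
  ext a
  refine ⟨fun h => h.of_tendsto_sub huv, fun h => h.of_tendsto_sub ?_⟩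
  simpa using huv.neg

/-! ### Choice of the stages and of the digit windows. -/

/-- Stage starts that exceed the given thresholds. -/
def stageStart (thr : ℕ → ℕ) : ℕ → ℕ
  | 0 => 0
  -- The product contains the periods of both adjacent stages, for divisibility. The three summands
  -- give `ratio`, `period_le` and the threshold.
  | k + 1 => (k.factorial * (k + 1)) * ((k + 1).factorial * (k + 1 + 1)) *
      ((k + 1) * stageStart thr k + (k + 1 + 1) + thr (k + 1))

lemma le_stageStart_succ (thr : ℕ → ℕ) (k : ℕ) :
    (k + 1) * stageStart thr k + (k + 1 + 1) + thr (k + 1) ≤ stageStart thr (k + 1) := by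
  have := k.factorial_pos
  have := (k + 1).factorial_pos
  exact Nat.le_mul_of_pos_left _ (by positivity)

lemma isStageStarts_stageStart (thr : ℕ → ℕ) : IsStageStarts (stageStart thr) where
  zero := rfl
  strictMono := strictMono_nat_of_lt_succ fun k => by
    have := le_stageStart_succ thr k
    nlinarith
  dvd k := by
    cases k with
    | zero => exact dvd_zero _
    | succ k => exact (Dvd.intro_left _ rfl : _ ∣ (k.factorial * (k + 1)) *
        ((k + 1).factorial * (k + 1 + 1))).mul_right _
  dvd_succ k := (Dvd.intro _ rfl : _ ∣ (k.factorial * (k + 1)) *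
        ((k + 1).factorial * (k + 1 + 1))).mul_right _
  period_le k hk := by
    cases k with
    | zero => omega
    | succ k =>
      have h1 := k.factorial_pos
      have h2 : (k + 1).factorial * (k + 1 + 1) ≤
          (k.factorial * (k + 1)) * ((k + 1).factorial * (k + 1 + 1)) :=
        Nat.le_mul_of_pos_left _ (by positivity)
      rw [mul_comm, stageStart]
      exact Nat.mul_le_mul h2 (by omega)
  ratio k := by
    have := le_stageStart_succ thr k
    omega

/-- Rounding both ends inwards and giving up one more digit, to keep away from the maximal digit `q
- 1`, costs at most 3, which is at most half of `δ q` because `δ q ≥ 6`. -/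
lemma exists_digit_window {q : ℕ} {α β δ : ℝ} (hα : 0 ≤ α) (hβ : β ≤ 1) (hδ : 0 < δ)
    (hαβ : δ ≤ β - α) (hq : 6 / δ ≤ q) : ∃ a w : ℕ, 1 ≤ w ∧ a + w + 1 ≤ q ∧
      α * q ≤ a ∧ ((a + w : ℕ) : ℝ) ≤ β * q ∧ δ / 2 * q ≤ w := by
  rw [div_le_iff₀ hδ] at hq
  have hq0 : (0 : ℝ) ≤ q := Nat.cast_nonneg _
  have h1 := Nat.ceil_lt_add_one (mul_nonneg hα hq0)
  have h2 := Nat.le_ceil (α * q)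
  have h3 := Nat.lt_floor_add_one (β * q)
  have h4 := Nat.floor_le (mul_nonneg (by linarith : 0 ≤ β) hq0)
  have h5 : δ * q ≤ β * q - α * q := by nlinarith
  have h6 : β * q ≤ q := by nlinarith
  have h7 : ⌈α * q⌉₊ + 1 + 1 ≤ ⌊β * q⌋₊ := by
    have : ((⌈α * q⌉₊ + 1 + 1 : ℕ) : ℝ) < (⌊β * q⌋₊ + 1 : ℕ) := by
      push_cast
      linarith
    have : ⌈α * q⌉₊ + 1 + 1 < ⌊β * q⌋₊ + 1 := by exact_mod_cast this
    omega
  obtain ⟨w, hw⟩ := Nat.exists_eq_add_of_le h7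
  have hw' : (⌊β * q⌋₊ : ℝ) = ⌈α * q⌉₊ + 1 + 1 + w := by exact_mod_cast hw
  refine ⟨⌈α * q⌉₊, w + 1, by omega, ?_, h2, ?_, ?_⟩
  · have : (⌊β * q⌋₊ : ℝ) ≤ q := h4.trans h6
    have : ⌊β * q⌋₊ ≤ q := by exact_mod_cast this
    omega
  · push_cast
    linarith
  · push_cast
    linarith

/-- Digit windows of relative size `q^{o(1)}` that force the terms `T_{Q,n}(x)` to follow the
stages. -/
lemma exists_windows {q : ℕ → ℕ} (hq : IsBasicSequence q) (hlim : InfiniteInLimit q)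
    {fup flow : ℕ → ℕ → unitInterval → unitInterval}
    (hup : IsLinearFamilyADF fup) (hlow : IsLinearFamilyADF flow) :
    ∃ S a w : ℕ → ℕ, IsStageStarts S ∧ (∀ n, 1 ≤ w n) ∧ (∀ n, a n + w n + 1 ≤ q (n + 1)) ∧
      (∀ ε : ℝ, 0 < ε → ∀ᶠ n in atTop, (q (n + 1) : ℝ) ≤ (q n : ℝ) ^ ε * w n) ∧
      ∀ T : ℕ → ℝ, (∀ n, T n ∈ Set.Ico ((a n : ℝ) / q (n + 1))
        (((a n + w n : ℕ) : ℝ) / q (n + 1))) → FollowsStages S fup flow T := by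
  have hwin : ∀ k ρ j : ℕ, ∃ s α β : ℝ, ρ < k.factorial → j < k + 1 →
      IsLevelWindow (realExtend (stageFamily fup flow k k.factorial ρ))
        (((j : ℝ) + 1) / ((k + 1 : ℕ) : ℝ)) s α β ∧ 0 ≤ α ∧ β ≤ 1 ∧
        β - α ≤ 1 / ((k : ℝ) + 1) := by
    intro k ρ j
    by_cases h : ρ < k.factorial ∧ j < k + 1
    · have hf := (hup.stageFamily hlow k).isADF _ _ h.1
      have hy : ((j : ℝ) + 1) / ((k + 1 : ℕ) : ℝ) ≤ 1 := by
        rw [div_le_one (by positivity)]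
        exact_mod_cast h.2
      obtain ⟨s, α, β, h1⟩ := exists_isLevelWindow hf.monotone.realExtend
        (fun t => hf.realExtend_of_nonpos) (fun t => hf.realExtend_of_one_le) (by positivity) hy
        (show 0 < 1 / ((k : ℝ) + 1) by positivity)
      exact ⟨s, α, β, fun _ _ => h1⟩
    -- Dummy values outside the relevant range, so that the choice below is of total functions.
    · exact ⟨0, 0, 0, fun h1 h2 => absurd ⟨h1, h2⟩ h⟩
  choose s α β hw using hwin
  -- Stage `k` involves finitely many windows, so their lengths have a positive lower bound, known
  -- before the stage starts are fixed.
  have hδ : ∀ k, ∃ δ : ℝ, 0 < δ ∧ ∀ ρ < k.factorial, ∀ j < k + 1, δ ≤ β k ρ j - α k ρ j := by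
    intro k
    have h1 : ∀ᶠ δ : ℝ in 𝓝[>] 0, ∀ ρ ∈ Finset.range k.factorial, ∀ j ∈ Finset.range (k + 1),
        δ ≤ β k ρ j - α k ρ j := by
      refine (Finset.eventually_all _).2 fun ρ hρ => (Finset.eventually_all _).2 fun j hj => ?_
      have := (hw k ρ j (Finset.mem_range.1 hρ) (Finset.mem_range.1 hj)).1.lt
      filter_upwards [Ioo_mem_nhdsGT (sub_pos.2 this)] with δ hδ using hδ.2.le
    obtain ⟨δ, hδ1, hδ2⟩ := (h1.and self_mem_nhdsWithin).exists
    exact ⟨δ, hδ2, fun ρ hρ j hj => hδ1 ρ (Finset.mem_range.2 hρ) j (Finset.mem_range.2 hj)⟩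
  choose δ hδ0 hδ using hδ
  -- The first bound leaves room for the digits. The second makes the loss `2 / δ k` at most `q n ^
  -- (1 / (k + 1))`, hence at most `q n ^ ε` in late stages.
  have hthr : ∀ k, ∃ n₀, ∀ n ≥ n₀, 6 / δ k ≤ q n ∧ (2 / δ k) ^ (k + 1) ≤ q n := by
    intro k
    have h1 : Tendsto (fun n => (q n : ℝ)) atTop atTop := tendsto_natCast_atTop_atTop.comp hlim
    exact eventually_atTop.1 ((h1.eventually_ge_atTop _).and (h1.eventually_ge_atTop _))
  choose thr hthr using hthr
  have hS := isStageStarts_stageStart thr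
  have hSthr : ∀ k, 1 ≤ k → thr k ≤ stageStart thr k ∧ 1 ≤ stageStart thr k := by
    intro k hk
    obtain ⟨k, rfl⟩ := Nat.exists_eq_add_of_le' hk
    have := le_stageStart_succ thr k
    constructor <;> omega
  generalize stageStart thr = S at hS hSthr
  have hdig : ∀ N, ∃ a w : ℕ, 1 ≤ w ∧ a + w + 1 ≤ q (N + 1) ∧ ∀ k, 1 ≤ k → S k ≤ N →
      N < S (k + 1) →
      α k (N % k.factorial) (N / k.factorial % (k + 1)) * q (N + 1) ≤ a ∧
      ((a + w : ℕ) : ℝ) ≤ β k (N % k.factorial) (N / k.factorial % (k + 1)) * q (N + 1) ∧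
      δ k / 2 * q (N + 1) ≤ w := by
    intro N
    by_cases hN : 1 ≤ stageOf S N
    · have hle := hS.start_le N
      have hρ := Nat.mod_lt N (stageOf S N).factorial_pos
      have hj := Nat.mod_lt (N / (stageOf S N).factorial) (Nat.succ_pos (stageOf S N))
      have h1 := hw _ _ _ hρ hj
      obtain ⟨a, w, h2, h3, h4⟩ := exists_digit_window (q := q (N + 1)) h1.2.1 h1.2.2.1 (hδ0 _)
        (hδ _ _ hρ _ hj) (hthr _ (N + 1) (by have := (hSthr _ hN).1; omega)).1
      refine ⟨a, w, h2, h3, fun k hk hk1 hk2 => ?_⟩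
      rw [hS.stageOf_eq hk1 hk2] at h4
      exact h4
    -- Stage 0 carries no requirement; the single digit 0 is allowed there, as `q (N + 1) ≥ 2`.
    · refine ⟨0, 1, le_rfl, hq (N + 1) (by omega), fun k hk hk1 hk2 => ?_⟩
      rw [hS.stageOf_eq hk1 hk2] at hN
      exact absurd hk hN
  choose a w hw1 haw hdig using hdig
  refine ⟨S, a, w, hS, hw1, haw, fun ε hε => ?_, fun T hT => ?_⟩
  · have hinv : Tendsto (fun k : ℕ => 1 / ((k : ℝ) + 1)) atTop (𝓝 0) :=
      tendsto_one_div_add_atTop_nhds_zero_nat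
    obtain ⟨K, hK⟩ := eventually_atTop.1 ((hinv.eventually_le_const hε).and
      (eventually_ge_atTop 1))
    filter_upwards [eventually_ge_atTop (S K)] with N hN
    obtain ⟨k, hk⟩ : ∃ k, k = stageOf S N := ⟨_, rfl⟩
    have hKk : K ≤ k := hk ▸ hS.le_stageOf hN
    have hk1 := (hK k hKk).2
    have h1 : S k ≤ N := hk ▸ hS.start_le N
    have h2 : N < S (k + 1) := hk ▸ hS.lt_succ_start N
    have h3 := (hdig N k hk1 h1 h2).2.2
    have h4 := (hthr k N ((hSthr k hk1).1.trans h1)).2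
    have hqN : (1 : ℝ) ≤ q N := by
      have := hq N ((hSthr k hk1).2.trans h1)
      exact_mod_cast (by omega : 1 ≤ q N)
    have hδk := hδ0 k
    have h5 : 2 / δ k ≤ (q N : ℝ) ^ ε := by
      calc 2 / δ k = ((2 / δ k) ^ (k + 1)) ^ (1 / ((k : ℝ) + 1)) := by
            rw [one_div, ← Nat.cast_succ, Real.pow_rpow_inv_natCast (by positivity) (by omega)]
        _ ≤ (q N : ℝ) ^ (1 / ((k : ℝ) + 1)) :=
            Real.rpow_le_rpow (by positivity) h4 (by positivity)
        _ ≤ (q N : ℝ) ^ ε := Real.rpow_le_rpow_of_exponent_le hqN (hK k hKk).1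
    calc (q (N + 1) : ℝ) = 2 / δ k * (δ k / 2 * q (N + 1)) := by field_simp
      _ ≤ (q N : ℝ) ^ ε * w N := mul_le_mul h5 h3 (by positivity) (by positivity)
  · intro k hk N hN1 hN2
    have hρ := Nat.mod_lt N k.factorial_pos
    have hj := Nat.mod_lt (N / k.factorial) (Nat.succ_pos k)
    have h1 := hw k _ _ hρ hj
    have h2 := hdig N k hk hN1 hN2
    have hqpos : (0 : ℝ) < q (N + 1) := by linarith [hq.two_le_cast N]
    refine ⟨_, _, _, h1.1, h1.2.2.2, ?_, ?_⟩
    · exact ((le_div_iff₀ hqpos).2 h2.1).trans (hT N).1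
    · exact (hT N).2.trans_le ((div_le_iff₀ hqpos).2 h2.2.1)

/-! ### The dimension theorem. -/

theorem mainTheorem7 (q : ℕ → ℕ) (hq : IsBasicSequence q) (hlim : InfiniteInLimit q)
    (fup flow : ℕ → ℕ → unitInterval → unitInterval)
    (hup : IsLinearFamilyADF fup) (hlow : IsLinearFamilyADF flow)
    (hle : ∀ m r : ℕ, r < m → ∀ t : unitInterval, flow m r t ≤ fup m r t) :
    dimH {x : ℝ | ∃ E : ℕ → ℤ, IsCantorExpansion q x E ∧
      ∀ m r : ℕ, r < m →
        HasUpperADF (fun n => cantorT q (m * n + r) x) (fup m r) ∧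
        HasLowerADF (fun n => cantorT q (m * n + r) x) (flow m r) ∧
        accPoints (fun n => (E (m * n + r + 1) : ℝ) / (q (m * n + r + 1) : ℝ)) =
          ((↑) : unitInterval → ℝ) '' (increaseSet (fup m r) ∪ increaseSet (flow m r))} = 1 := by
  refine le_antisymm ((dimH_mono (Set.subset_univ _)).trans Real.dimH_univ.le) ?_
  obtain ⟨S, a, w, hS, hw, haw, hgrowth, hfollow⟩ := exists_windows hq hlim hup hlow
  refine one_le_dimH_of_windows hq hw haw (fun ε hε => cantorProd_growth hq hw hε (hgrowth ε hε))
    fun d hd => ?_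
  have hd2 : ∀ n, d n + 2 ≤ q (n + 1) := fun n => by
    have := hd n
    have := haw n
    omega
  refine ⟨_, hq.isCantorExpansion hd2, fun m r hr => ?_⟩
  have hTmem := hq.cantorT_mem hd2
  have hqpos : ∀ n, (0 : ℝ) < q (n + 1) := fun n => by linarith [hq.two_le_cast n]
  have hT : FollowsStages S fup flow fun n => cantorT q n (cantorPoint q d) := by
    refine hfollow _ fun n => ⟨le_trans ?_ (hTmem n).1, (hTmem n).2.trans_le ?_⟩
    · exact div_le_div_of_nonneg_right (by exact_mod_cast (hd n).1) (hqpos n).le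
    · exact div_le_div_of_nonneg_right (by exact_mod_cast (hd n).2) (hqpos n).le
  have hT0 : ∀ n, 0 ≤ cantorT q n (cantorPoint q d) := fun n => Int.fract_nonneg _
  refine ⟨hT.hasUpperADF hS hup hlow hle hT0 hr, hT.hasLowerADF hS hup hlow hle hT0 hr, ?_⟩
  rw [← hT.accPoints_eq hS hup hlow hle hT0 hr]
  -- The digit quotient is the left end of an interval of length `1 / q (m * n + r + 1)` that
  -- contains the orbit term, and this length tends to `0`.
  refine accPoints_congr ?_
  have hidx : Tendsto (fun n => m * n + r + 1) atTop atTop :=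
    tendsto_atTop_mono (fun n => by nlinarith : ∀ n, n ≤ m * n + r + 1) tendsto_id
  have hinv : Tendsto (fun n => ((q (m * n + r + 1) : ℝ))⁻¹) atTop (𝓝 0) :=
    tendsto_inv_atTop_zero.comp (tendsto_natCast_atTop_atTop.comp (hlim.comp hidx))
  refine squeeze_zero_norm (fun n => ?_) hinv
  have h := hTmem (m * n + r)
  have hsplit : ((d (m * n + r) : ℝ) + 1) / q (m * n + r + 1) =
      (d (m * n + r) : ℝ) / q (m * n + r + 1) + ((q (m * n + r + 1) : ℝ))⁻¹ := by
    rw [add_div, one_div]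
  rw [hsplit] at h
  have hE : (((if m * n + r + 1 = 0 then 0 else (d (m * n + r + 1 - 1) : ℤ)) : ℤ) : ℝ) =
      d (m * n + r) := by
    simp
  rw [hE, Real.norm_eq_abs, abs_le]
  have := inv_pos.2 (hqpos (m * n + r))
  constructor <;> linarith [h.1, h.2]
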